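/- Let $R$ be a commutative ring, $p$ a prime number and $q\in R$. For $n\ge 0$ put $(n)_u=1+u+\dots+u^{n-1}$, $(n)_u!=\prod_{i=1}^n (i)_u$ and $\binom{n}{k}_u=\frac{(n)_u!}{(k)_u!\,(n-k)_u!}$ in $\mathbb Z[u]$ (with $\binom nk_u=0$ for $k>n$). Assume that $(p)_q=0$ in $R$ and that $R$ is $q$-divisible: for every $m\in\mathbb N$, $(m)_q$ is invertible in $R$ if it is nonzero. Let $A$ be a commutative $R$-algebra with an étale morphism of $R$-algebras $f:R[t]\to A$, and put $x=f(t)$. Let $\sigma:A\to A$ be a morphism of $R$-algebras with $\sigma(x)=qx$ and $\sigma^p=\mathrm{id}_A$, and let $\partial_\sigma:A\to A$ be an $R$-linear map with $\partial_\sigma(ab)=\partial_\sigma(a)b+\sigma(a)\partial_\sigma(b)$ for all $a,b\in A$ and $\partial_\sigma(x)=1$. Let $\mathrm D_{A,\sigma}$ be the Ore extension of $A$ by $\sigma$ and $\partial_\sigma$: the free left $A$-module on $\partial_\sigma^k$ ($k\ge 0$) with the ring structure given by $\partial_\sigma z=\sigma(z)\partial_\sigma+\partial_\sigma(z)$ for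 $z\in A$. Let $\mathrm{ZD}_{A,\sigma}$ be its centre and $\mathrm{ZA}_{A,\sigma}$ the centralizer of $A$ in it. Define $A_{n,i},B_{n,i}\in\mathbb Z[u]$ by $$A_{n,i}(u)=\sum_{j=0}^n(-1)^{n-j}u^{\frac{p(n-j)(n-j-1)}2}\binom nj_{u^p}\binom{pj}{i}_u,\qquad (i)_u!\,A_{n,i}(u)=(n)_{u^p}!\,(p)_u^n\,B_{n,i}(u),$$ and let $\Phi_{A,\sigma}:\mathrm D_{A,\sigma}\to \mathrm{ZA}_{A,\sigma}$ be the $q$-divided Frobenius map, that is, the left $A$-linear map with $$\Phi_{A,\sigma}(\partial_\sigma^n)=\sum_{k=0}^n B_{k,n}(q)\,x^{pk-n}\,\partial_\sigma^{pk}$$ (where $B_{k,n}=0$ if $pk<n$). Then $\partial_\sigma^p$ is central in $\mathrm D_{A,\sigma}$. Let $\widehat{\mathrm D_{A,\sigma}}$, $\widehat{\mathrm{ZD}_{A,\sigma}}$, $\widehat{\mathrm{ZA}_{A,\sigma}}$ be the adic completions of $\mathrm D_{A,\sigma}$, $\mathrm{ZD}_{A,\sigma}$, $\mathrm{ZA}_{A,\sigma}$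 with respect to $\partial_\sigma^p$. The map $\Phi_{A,\sigma}$ induces an isomorphism of $A$-algebras $$\widehat{\mathrm D_{A,\sigma}}\ \xrightarrow{\ \sim\ }\ \mathrm{End}_{\widehat{\mathrm{ZD}_{A,\sigma}}}\bigl(\widehat{\mathrm{ZA}_{A,\sigma}}\bigr).$$ More precisely, there is exactly one ring isomorphism $e$ between these two rings such that $e(a)$ is multiplication by $a$ for every $a\in A$ and $e(P)(z)=\Phi_{A,\sigma}(Pz)$ for all $P\in \mathrm D_{A,\sigma}$ and $z\in A$, where $Pz$ is the product in $\mathrm D_{A,\sigma}$. -/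

import Mathlib

open Polynomial

noncomputable section

namespace TwistedDiff

/-! ### q-analogues, as polynomials in one indeterminate `u` -/

/-- The q-integer `(n)_u = (u ^ n - 1) / (u - 1) = 1 + u + ... + u ^ (n - 1)`. -/
def qInt (n : ℕ) : ℤ[X] := ∑ i ∈ Finset.range n, X ^ i

/-- The q-factorial `(n)_u! = (1)_u (2)_u ... (n)_u`. -/
def qFactorial (n : ℕ) : ℤ[X] := ∏ i ∈ Finset.Icc 1 n, qInt i

/-- The q-binomial coefficient `(n)_u! / ((k)_u! (n - k)_u!)`, zero for `k > n`.
The divisor is monic and the division is exact. -/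
def qBinom (n k : ℕ) : ℤ[X] :=
  if k ≤ n then qFactorial n /ₘ (qFactorial k * qFactorial (n - k)) else 0

/-- `A_{n,i}(u) = ∑_j (-1)^(n-j) u^(p(n-j)(n-j-1)/2) (n choose j)_{u^p} (pj choose i)_u`. -/
def polyA (p n i : ℕ) : ℤ[X] :=
  ∑ j ∈ Finset.range (n + 1),
    (-1) ^ (n - j) * X ^ (p * ((n - j) * (n - j - 1) / 2)) *
      expand ℤ p (qBinom n j) * qBinom (p * j) i

/-- `B_{n,i}(u)`, characterised by `(i)_u! A_{n,i}(u) = (n)_{u^p}! (p)_u^n B_{n,i}(u)`.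
The divisor is monic and the division is exact. -/
def polyB (p n i : ℕ) : ℤ[X] :=
  (qFactorial i * polyA p n i) /ₘ (expand ℤ p (qFactorial n) * qInt p ^ n)

/-- `R` is q-divisible: each `(m)_q` is invertible in `R` if it is nonzero. -/
def IsQDivisible {R : Type*} [CommRing R] (q : R) : Prop :=
  ∀ m : ℕ, aeval q (qInt m) ≠ 0 → IsUnit (aeval q (qInt m))

/-! ### Twisted derivations and the Ore extension -/

/-- A `σ`-derivation of `A` over `R`. -/
structure SigmaDerivation {R A : Type*} [CommRing R] [CommRing A] [Algebra R A]
    (σ : A →ₐ[R] A) extends A →ₗ[R] A where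
  leibniz' : ∀ a b : A, toFun (a * b) = toFun a * b + σ a * toFun b

variable {R A : Type*} [CommRing R] [CommRing A] [Algebra R A] {σ : A →ₐ[R] A}

instance : CoeFun (SigmaDerivation σ) (fun _ => A → A) := ⟨fun δ => δ.toLinearMap⟩

theorem SigmaDerivation.leibniz (δ : SigmaDerivation σ) (a b : A) :
    δ (a * b) = δ a * b + σ a * δ b := δ.leibniz' a b

/-- The ring `D_{A,σ}` of twisted differential operators, i.e. the Ore extension of `A` by `σ` and
the `σ`-derivation `δ`: the free `A`-module on generators `∂ ^ n`, `n ≥ 0` (the function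
`n ↦ a n` stands for `∑ a n ∂ ^ n`), with the ring structure in which
`∂ z = σ z ∂ + δ z` for `z` in `A`. -/
def OreExt (_δ : SigmaDerivation σ) : Type _ := ℕ →₀ A

namespace OreExt

variable (δ : SigmaDerivation σ)

instance : AddCommGroup (OreExt δ) := inferInstanceAs (AddCommGroup (ℕ →₀ A))
instance : Module A (OreExt δ) := inferInstanceAs (Module A (ℕ →₀ A))

/-- The operator `a ∂ ^ n`. -/
def monomial (n : ℕ) : A →+ OreExt δ := Finsupp.singleAddHom n

/-- Additive maps out of `D_{A,σ}` are given by their values on the `a ∂ ^ n`. -/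
def liftAdd {M : Type*} [AddCommMonoid M] (g : ℕ → A →+ M) : OreExt δ →+ M :=
  Finsupp.liftAddHom g

@[simp] theorem liftAdd_monomial {M : Type*} [AddCommMonoid M] (g : ℕ → A →+ M) (n : ℕ) (a : A) :
    liftAdd δ g (monomial δ n a) = g n a :=
  Finsupp.liftAddHom_apply_single g n a

variable {δ} in
theorem addHom_ext {M : Type*} [AddCommMonoid M] {g h : OreExt δ →+ M}
    (H : ∀ n a, g (monomial δ n a) = h (monomial δ n a)) : g = h :=
  Finsupp.addHom_ext H

@[simp] theorem smul_monomial (a b : A) (n : ℕ) :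
    a • monomial δ n b = monomial δ n (a * b) :=
  Finsupp.smul_single a n b

/-- Left multiplication by `∂`: `b ∂ ^ m ↦ σ b ∂ ^ (m + 1) + δ b ∂ ^ m`. -/
def mulDel : AddMonoid.End (OreExt δ) :=
  liftAdd δ fun m =>
    (monomial δ (m + 1)).comp (σ : A →+ A) + (monomial δ m).comp (δ.toLinearMap : A →+ A)

theorem mulDel_monomial (m : ℕ) (b : A) :
    mulDel δ (monomial δ m b) = monomial δ (m + 1) (σ b) + monomial δ m (δ b) := by
  unfold mulDel
  exact liftAdd_monomial δ _ m b

/-- Left multiplication by `∑ a n ∂ ^ n`, in terms of left multiplication by `∂`. -/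
def mulL : OreExt δ →+ AddMonoid.End (OreExt δ) :=
  liftAdd δ fun n =>
    (AddMonoidHom.mulRight (mulDel δ ^ n)).comp (Module.toAddMonoidEnd A (OreExt δ) : A →+ _)

theorem mulL_monomial (n : ℕ) (a : A) (g : OreExt δ) :
    mulL δ (monomial δ n a) g = a • (mulDel δ ^ n) g := by
  unfold mulL
  rw [liftAdd_monomial]
  rfl

theorem mulDel_smul (a : A) (g : OreExt δ) :
    mulDel δ (a • g) = σ a • mulDel δ g + δ a • g := by
  have : mulDel δ * Module.toAddMonoidEnd A (OreExt δ) a =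
      Module.toAddMonoidEnd A (OreExt δ) (σ a) * mulDel δ +
        Module.toAddMonoidEnd A (OreExt δ) (δ a) := by
    apply addHom_ext
    intro n b
    change mulDel δ (a • monomial δ n b) = σ a • mulDel δ (monomial δ n b) + δ a • monomial δ n b
    rw [smul_monomial, mulDel_monomial, mulDel_monomial, smul_add, smul_monomial, smul_monomial,
      smul_monomial, map_mul, δ.leibniz, map_add]
    abel
  exact DFunLike.congr_fun this g

theorem mulL_mulDel (g h : OreExt δ) : mulL δ (mulDel δ g) h = mulDel δ (mulL δ g h) := by
  have : (AddMonoidHom.eval h).comp ((mulL δ).comp (mulDel δ)) =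
      (mulDel δ).comp ((AddMonoidHom.eval h).comp (mulL δ)) := by
    apply addHom_ext
    intro n b
    change mulL δ (mulDel δ (monomial δ n b)) h = mulDel δ (mulL δ (monomial δ n b) h)
    rw [mulDel_monomial, map_add]
    change mulL δ (monomial δ (n + 1) (σ b)) h + mulL δ (monomial δ n (δ b)) h = _
    rw [mulL_monomial, mulL_monomial, mulL_monomial, mulDel_smul, pow_succ']
    rfl
  exact DFunLike.congr_fun this g

theorem mulL_smul (a : A) (g h : OreExt δ) : mulL δ (a • g) h = a • mulL δ g h := by
  have : (AddMonoidHom.eval h).comp ((mulL δ).comp (Module.toAddMonoidEnd A (OreExt δ) a)) =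
      (Module.toAddMonoidEnd A (OreExt δ) a).comp ((AddMonoidHom.eval h).comp (mulL δ)) := by
    apply addHom_ext
    intro n b
    change mulL δ (a • monomial δ n b) h = a • mulL δ (monomial δ n b) h
    rw [smul_monomial, mulL_monomial, mulL_monomial, mul_smul]
  exact DFunLike.congr_fun this g

theorem mulL_mulL (f g h : OreExt δ) : mulL δ (mulL δ f g) h = mulL δ f (mulL δ g h) := by
  have hn : ∀ (n : ℕ) (g : OreExt δ),
      mulL δ ((mulDel δ ^ n) g) h = (mulDel δ ^ n) (mulL δ g h) := by
    intro n
    induction n with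
    | zero => intro g; rfl
    | succ n ih =>
      intro g
      rw [pow_succ']
      change mulL δ (mulDel δ ((mulDel δ ^ n) g)) h = mulDel δ ((mulDel δ ^ n) (mulL δ g h))
      rw [mulL_mulDel, ih]
  have : (AddMonoidHom.eval h).comp ((mulL δ).comp ((AddMonoidHom.eval g).comp (mulL δ))) =
      (AddMonoidHom.eval (mulL δ g h)).comp (mulL δ) := by
    apply addHom_ext
    intro n b
    change mulL δ (mulL δ (monomial δ n b) g) h = mulL δ (monomial δ n b) (mulL δ g h)
    rw [mulL_monomial, mulL_monomial, mulL_smul, hn]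
  exact DFunLike.congr_fun this f

theorem mulL_one_left (g : OreExt δ) : mulL δ (monomial δ 0 1) g = g := by
  rw [mulL_monomial, one_smul]; rfl

theorem mulDel_pow_one (n : ℕ) : (mulDel δ ^ n) (monomial δ 0 1) = monomial δ n 1 := by
  have h1 : δ (1 : A) = 0 := by
    have := δ.leibniz 1 1
    simpa using this
  induction n with
  | zero => rfl
  | succ n ih =>
    rw [pow_succ']
    change mulDel δ ((mulDel δ ^ n) (monomial δ 0 1)) = _
    rw [ih, mulDel_monomial, map_one, h1, map_zero, add_zero]

theorem mulL_one_right (f : OreExt δ) : mulL δ f (monomial δ 0 1) = f := by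
  have : (AddMonoidHom.eval (monomial δ 0 1)).comp (mulL δ) = AddMonoidHom.id (OreExt δ) := by
    apply addHom_ext
    intro n b
    change mulL δ (monomial δ n b) (monomial δ 0 1) = monomial δ n b
    rw [mulL_monomial, mulDel_pow_one, smul_monomial, mul_one]
  exact DFunLike.congr_fun this f

instance : One (OreExt δ) := ⟨monomial δ 0 1⟩
instance : Mul (OreExt δ) := ⟨fun f g => mulL δ f g⟩

instance : Ring (OreExt δ) :=
  { (inferInstance : AddCommGroup (OreExt δ)) with
    one := 1
    mul := (· * ·)
    mul_assoc := mulL_mulL δ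
    one_mul := mulL_one_left δ
    mul_one := mulL_one_right δ
    left_distrib := fun f g h => map_add (mulL δ f) g h
    right_distrib := fun f g h => DFunLike.congr_fun (map_add (mulL δ) f g) h
    zero_mul := fun f => DFunLike.congr_fun (map_zero (mulL δ)) f
    mul_zero := fun f => map_zero (mulL δ f) }

theorem mul_def (f g : OreExt δ) : f * g = mulL δ f g := rfl

/-- The inclusion of `A` in `D_{A,σ}` as the operators of order zero. -/
def coeff : A →+* OreExt δ where
  toFun := monomial δ 0
  map_one' := rfl
  map_mul' a b := by
    rw [mul_def, mulL_monomial, ← smul_monomial]; rfl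
  map_zero' := map_zero _
  map_add' := map_add _

/-- The generator `∂` of `D_{A,σ}`. -/
def del : OreExt δ := monomial δ 1 1

theorem smul_eq_coeff_mul (a : A) (f : OreExt δ) : a • f = coeff δ a * f := by
  change a • f = mulL δ (monomial δ 0 a) f
  rw [mulL_monomial]; rfl

/-- The elements `a ∂ ^ n` are the expected products. -/
theorem monomial_eq (n : ℕ) (a : A) : monomial δ n a = coeff δ a * del δ ^ n := by
  have h : ∀ n : ℕ, del δ ^ n = monomial δ n 1 := by
    intro n
    induction n with
    | zero => rfl
    | succ n ih =>
      rw [pow_succ, ih, del, mul_def, mulL_monomial, one_smul]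
      have : monomial δ 1 (1 : A) = mulDel δ (monomial δ 0 1) := (mulDel_pow_one δ 1).symm
      rw [this, ← mulDel_pow_one δ (n + 1), pow_succ]
      rfl
  rw [h, ← smul_eq_coeff_mul, smul_monomial, mul_one]

/-- The commutation rule. -/
theorem del_mul_coeff (z : A) : del δ * coeff δ z = coeff δ (σ z) * del δ + coeff δ (δ z) := by
  rw [← smul_eq_coeff_mul]
  change mulL δ (monomial δ 1 1) (monomial δ 0 z) = σ z • monomial δ 1 1 + monomial δ 0 (δ z)
  rw [mulL_monomial, one_smul, pow_one, mulDel_monomial, smul_monomial, mul_one]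

end OreExt

/-! ### Completion of a ring with respect to a central element -/

/-- The completion `lim B / (c ^ n)` of a ring `B`, where `(c ^ n)` is the two-sided ideal
generated by `c ^ n`. This is the `c`-adic completion when `c` is central. -/
def Completion (B : Type*) [Ring B] (c : B) :
    Subring (∀ n : ℕ, (TwoSidedIdeal.span {c ^ n}).ringCon.Quotient) where
  carrier := {s | ∀ m n : ℕ, m ≤ n → ∃ b : B,
    (b : (TwoSidedIdeal.span {c ^ n}).ringCon.Quotient) = s n ∧
    (b : (TwoSidedIdeal.span {c ^ m}).ringCon.Quotient) = s m}
  mul_mem' {s t} hs ht m n h := by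
    obtain ⟨a, ha, ha'⟩ := hs m n h
    obtain ⟨b, hb, hb'⟩ := ht m n h
    exact ⟨a * b, by rw [RingCon.coe_mul, ha, hb]; rfl, by rw [RingCon.coe_mul, ha', hb']; rfl⟩
  one_mem' m n _ := ⟨1, rfl, rfl⟩
  add_mem' {s t} hs ht m n h := by
    obtain ⟨a, ha, ha'⟩ := hs m n h
    obtain ⟨b, hb, hb'⟩ := ht m n h
    exact ⟨a + b, by rw [RingCon.coe_add, ha, hb]; rfl, by rw [RingCon.coe_add, ha', hb']; rfl⟩
  zero_mem' m n _ := ⟨0, rfl, rfl⟩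
  neg_mem' {s} hs m n h := by
    obtain ⟨a, ha, ha'⟩ := hs m n h
    exact ⟨-a, by rw [RingCon.coe_neg, ha]; rfl, by rw [RingCon.coe_neg, ha']; rfl⟩

/-- The canonical map from a ring to its completion. -/
def Completion.of {B : Type*} [Ring B] (c : B) : B →+* Completion B c :=
  (RingHom.pi fun n => (TwoSidedIdeal.span {c ^ n}).ringCon.mk').codRestrict _
    fun b _ _ _ => ⟨b, rfl, rfl⟩

/-! ### Centre, centralizer of `A`, divided Frobenius -/

namespace OreExt

variable (δ : SigmaDerivation σ)

/-- The centre `ZD_{A,σ}` of `D_{A,σ}`. -/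
abbrev ZD : Subring (OreExt δ) := Subring.center (OreExt δ)

/-- The centralizer `ZA_{A,σ}` of `A` in `D_{A,σ}`. -/
abbrev ZA : Subring (OreExt δ) := Subring.centralizer (Set.range (coeff δ))

/-- The inclusion of `ZD_{A,σ}` in `ZA_{A,σ}`. -/
def inclZ : ZD δ →+* ZA δ := Subring.inclusion (Subring.center_le_centralizer _)

instance : Module (ZD δ) (ZA δ) := Module.compHom (ZA δ) (inclZ δ)

theorem zd_smul_def (z : ZD δ) (w : ZA δ) : z • w = inclZ δ z * w := rfl

/-- The inclusion of `A` in its centralizer `ZA_{A,σ}`. -/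
def coeffZA : A →+* ZA δ :=
  (coeff δ).codRestrict (ZA δ) (by
    rintro a _ ⟨b, rfl⟩
    rw [← map_mul, ← map_mul, mul_comm])

/-- Multiplication by `a ∈ A` on `ZA_{A,σ}`, as a `ZD_{A,σ}`-linear map. -/
def mulZA (a : A) : ZA δ →ₗ[ZD δ] ZA δ where
  toFun w := coeffZA δ a * w
  map_add' := mul_add _
  map_smul' z w := by
    have : coeffZA δ a * inclZ δ z = inclZ δ z * coeffZA δ a :=
      Subtype.ext ((Subring.mem_center_iff.1 z.2) _)
    rw [zd_smul_def, ← mul_assoc, this, mul_assoc]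
    rfl

variable {δ} {p : ℕ} (hθ : del δ ^ p ∈ Subring.center (OreExt δ))

/-- The element `∂ ^ p` of the centre, when it is central. -/
def theta : ZD δ := ⟨del δ ^ p, hθ⟩

/-- The completed centre: the adic completion of `ZD_{A,σ}` with respect to `∂ ^ p`. -/
abbrev ZDHat : Type _ := AdicCompletion (Ideal.span {theta hθ}) (ZD δ)

/-- The completed centralizer: the adic completion of `ZA_{A,σ}` with respect to `∂ ^ p`. -/
abbrev ZAHat : Type _ := AdicCompletion (Ideal.span {theta hθ}) (ZA δ)

/-- The q-divided Frobenius map `Φ_{A,σ} : D_{A,σ} → ZA_{A,σ}`, the `A`-linear map with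
`∂ ^ n ↦ ∑_{k ≤ n} B_{k,n}(q) x ^ (p k - n) ∂ ^ (p k)`. Here `B_{k,n} = 0` unless `n ≤ p k`. -/
def Phi (q : R) (x : A) : OreExt δ →+ ZA δ :=
  liftAdd δ fun n =>
    (AddMonoidHom.mulRight (∑ k ∈ Finset.range (n + 1),
      coeffZA δ (algebraMap R A (aeval q (polyB p k n)) * x ^ (p * k - n)) *
        inclZ δ (theta hθ) ^ k)).comp (coeffZA δ : A →+ ZA δ)

theorem Phi_monomial (q : R) (x : A) (n : ℕ) (a : A) :
    Phi hθ q x (coeff δ a * del δ ^ n) = coeffZA δ a * ∑ k ∈ Finset.range (n + 1),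
      coeffZA δ (algebraMap R A (aeval q (polyB p k n)) * x ^ (p * k - n)) *
        inclZ δ (theta hθ) ^ k := by
  rw [← monomial_eq, Phi, liftAdd_monomial]
  rfl

theorem Phi_smul (q : R) (x : A) (a : A) (P : OreExt δ) :
    Phi hθ q x (a • P) = coeffZA δ a * Phi hθ q x P := by
  have : (Phi hθ q x).comp (DistribSMul.toAddMonoidHom (OreExt δ) a) =
      (AddMonoidHom.mulLeft (coeffZA δ a)).comp (Phi hθ q x) := by
    apply addHom_ext
    intro n b
    change Phi hθ q x (a • monomial δ n b) = coeffZA δ a * Phi hθ q x (monomial δ n b)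
    rw [smul_monomial, monomial_eq, monomial_eq, Phi_monomial, Phi_monomial, map_mul, mul_assoc]
  exact DFunLike.congr_fun this P

end OreExt

end TwistedDiff

end

noncomputable section
namespace TwistedDiff

/-! ### Identities between q-analogues -/

/-! Write θ for `∂ ^ p`, δ for the σ-derivation and `x = f(X)`. The map Φ turns out to be the orbit
map of 1 for an action of D on ZA, and this action is an isomorphism onto all endomorphisms after
completion.

Étaleness enters through one fact: an R-linear derivation of A killing `x` is zero. It gives `δσ =
qσδ`, hence a q-binomial formula for `∂ ^ n a`. Since `(p)_q = 0`, the middle q-binomials of order p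
vanish at q, so `∂ ^ p a = a ∂ ^ p + δ ^ p(a)`. Thus `δ ^ p` is a derivation killing `x`, so it is
zero and θ is central (`isCoordinate_of_etale`). Since `(k)_q!` is a unit for k < p, a q-Taylor
expansion shows that A is free over the constants, the kernel of δ, with basis `1, x, …, x ^ (p -
1)`. Comparing coefficients, ZA = A[θ] and ZD = (constants)[θ], so ZA is free over ZD on the same
basis.

Let A act on ZA by multiplication and let ∂ act ZD-linearly by `a ↦ δ(a) + x ^ (p - 1) σ(a) θ`. The
Ore relation holds, so this is an action of D. The recursion `B_{k+1,n+1} = u ^ (pk-n) B_{k,n} +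
(p(k+1)-n)_u B_{k+1,n}` identifies `∂ ^ n · 1` with `Φ(∂ ^ n)` (`twistDel_pow_one`), hence `P · z =
(Pz) · 1 = Φ(Pz)` for z in A (`action_coeffZA`).

Modulo θ the action becomes the ordinary action of D on A, with ∂ acting by δ. In the basis `x ^ k`
it is triangular with diagonal entries `(k)_q!`, so D/∂^p is identified with the endomorphisms
modulo θ. Moreover `∂ ^ p` acts as θ times a unit modulo θ, because `B_{1,p}(q) = (p-1)_q!`
(`action_del_pow`). Successive approximation then gives the isomorphism of completions
(`IsAdicEquiv.equiv`). Uniqueness holds because every ring homomorphism with the prescribed values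
on D is automatically continuous (`IsAdicEquiv.ringHom_ext`). -/

theorem qInt_zero : qInt 0 = 0 := by simp [qInt]

theorem qInt_one : qInt 1 = 1 := by simp [qInt]

theorem qInt_succ (n : ℕ) : qInt (n + 1) = qInt n + X ^ n := by
  simp [qInt, Finset.sum_range_succ]

theorem qInt_add (m n : ℕ) : qInt (m + n) = qInt m + X ^ m * qInt n := by
  induction n with
  | zero => simp [qInt_zero]
  | succ n ih => rw [← add_assoc, qInt_succ, ih, qInt_succ]; ring

theorem qInt_mul (m n : ℕ) : qInt (m * n) = qInt m * expand ℤ m (qInt n) := by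
  induction n with
  | zero => simp [qInt_zero]
  | succ n ih =>
    rw [mul_add, mul_one, qInt_add, ih, qInt_succ, map_add, map_pow, expand_X]; ring

theorem qInt_monic {n : ℕ} (hn : n ≠ 0) : (qInt n).Monic := monic_geom_sum_X hn

theorem qInt_ne_zero {n : ℕ} (hn : n ≠ 0) : qInt n ≠ 0 := (qInt_monic hn).ne_zero

theorem qFactorial_zero : qFactorial 0 = 1 := by simp [qFactorial]

theorem qFactorial_succ (n : ℕ) : qFactorial (n + 1) = qFactorial n * qInt (n + 1) := by
  simp [qFactorial, Finset.prod_Icc_succ_top]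

theorem qFactorial_monic (n : ℕ) : (qFactorial n).Monic := by
  induction n with
  | zero => rw [qFactorial_zero]; exact monic_one
  | succ n ih => rw [qFactorial_succ]; exact ih.mul (qInt_monic n.succ_ne_zero)

theorem qFactorial_ne_zero (n : ℕ) : qFactorial n ≠ 0 := (qFactorial_monic n).ne_zero

/-- The q-binomial coefficients, given by the q-Pascal rule. -/
def qPascal : ℕ → ℕ → ℤ[X]
  | _, 0 => 1
  | 0, _ + 1 => 0
  | n + 1, k + 1 => qPascal n k + X ^ (k + 1) * qPascal n (k + 1)

theorem qPascal_zero_right (n : ℕ) : qPascal n 0 = 1 := by cases n <;> rfl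

theorem qPascal_succ_succ (n k : ℕ) :
    qPascal (n + 1) (k + 1) = qPascal n k + X ^ (k + 1) * qPascal n (k + 1) := rfl

theorem qPascal_eq_zero {n k : ℕ} (h : n < k) : qPascal n k = 0 := by
  induction n generalizing k with
  | zero => obtain ⟨k, rfl⟩ := Nat.exists_eq_succ_of_ne_zero h.ne'; rfl
  | succ n ih =>
    obtain ⟨k, rfl⟩ := Nat.exists_eq_succ_of_ne_zero (Nat.ne_zero_of_lt h)
    rw [Nat.succ_eq_add_one, qPascal_succ_succ, ih (by omega), ih (by omega)]; simp

theorem qPascal_self (n : ℕ) : qPascal n n = 1 := by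
  induction n with
  | zero => rfl
  | succ n ih => rw [qPascal_succ_succ, ih, qPascal_eq_zero n.lt_succ_self]; simp

theorem qPascal_add_mul (k m : ℕ) :
    qPascal (k + m) k * (qFactorial k * qFactorial m) = qFactorial (k + m) := by
  induction k generalizing m with
  | zero => simp [qPascal_zero_right, qFactorial_zero]
  | succ k ihk =>
    induction m with
    | zero => simp [qPascal_self, qFactorial_zero]
    | succ m ihm =>
      have h1 := ihk (m + 1)
      rw [show k + 1 + (m + 1) = k + (m + 1) + 1 by ring, qPascal_succ_succ, qFactorial_succ (k + (m + 1)),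
        show k + (m + 1) + 1 = (k + 1) + (m + 1) by ring, qInt_add (k + 1), ← h1]
      rw [show k + 1 + m = k + (m + 1) by ring] at ihm
      rw [qFactorial_succ m] at *
      rw [qFactorial_succ k] at *
      linear_combination (X ^ (k + 1) * qInt (m + 1)) * (ihm - h1)

/-- The factorial identity `qPascal_add_mul` makes the monic division exact; from here on,
q-binomials are handled by recursion instead of division. -/
theorem qBinom_eq_qPascal (n k : ℕ) : qBinom n k = qPascal n k := by
  unfold qBinom
  split_ifs with h
  · obtain ⟨m, rfl⟩ := Nat.exists_eq_add_of_le h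
    rw [← qPascal_add_mul, Nat.add_sub_cancel_left, mul_comm]
    exact mul_divByMonic_cancel_left _ ((qFactorial_monic _).mul (qFactorial_monic _))
  · exact (qPascal_eq_zero (by omega)).symm

theorem qInt_mul_qPascal_succ (n k : ℕ) :
    qInt (k + 1) * qPascal n (k + 1) = qInt (n - k) * qPascal n k := by
  rcases lt_or_ge k n with h | h
  · obtain ⟨m, rfl⟩ := Nat.exists_eq_add_of_le (Nat.succ_le_of_lt h)
    have h1 := qPascal_add_mul k (m + 1)
    have h2 := qPascal_add_mul (k + 1) m
    rw [show k.succ + m = k + 1 + m from rfl, show k + 1 + m - k = m + 1 by omega]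
    rw [show k + (m + 1) = k + 1 + m by ring, qFactorial_succ m] at h1
    rw [qFactorial_succ k] at h2
    apply mul_right_cancel₀ (mul_ne_zero (qFactorial_ne_zero k) (qFactorial_ne_zero m))
    linear_combination h2 - h1
  · rw [qPascal_eq_zero (by omega), Nat.sub_eq_zero_of_le h, qInt_zero]; simp

theorem qPascal_succ_mul_qInt {n k : ℕ} (h : k ≤ n) :
    qPascal (n + 1) k * qInt (n + 1 - k) = qInt (n + 1) * qPascal n k := by
  obtain ⟨m, rfl⟩ := Nat.exists_eq_add_of_le h
  have h1 := qPascal_add_mul k (m + 1)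
  have h2 := qPascal_add_mul k m
  rw [show k + m + 1 - k = m + 1 by omega]
  rw [← add_assoc, qFactorial_succ m, qFactorial_succ] at h1
  apply mul_right_cancel₀ (mul_ne_zero (qFactorial_ne_zero k) (qFactorial_ne_zero m))
  linear_combination h1 - qInt (k + m + 1) * h2

/-- The second form of the q-Pascal rule. -/
theorem qPascal_succ_succ' (n k : ℕ) :
    qPascal (n + 1) (k + 1) = X ^ (n - k) * qPascal n k + qPascal n (k + 1) := by
  rcases lt_or_ge k n with h | h
  · have h1 := qInt_mul_qPascal_succ (n + 1) k
    have h2 := qPascal_succ_mul_qInt h.le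
    have h3 := qInt_mul_qPascal_succ n k
    apply mul_left_cancel₀ (qInt_ne_zero k.succ_ne_zero)
    have h4 : qInt (n + 1) = qInt (n - k) + X ^ (n - k) * qInt (k + 1) := by
      rw [← qInt_add]; congr 1; omega
    linear_combination h1 + h2 - h3 + qPascal n k * h4
  · rcases h.eq_or_lt with rfl | h
    · simp [qPascal_self, qPascal_eq_zero]
    · simp [qPascal_eq_zero h, qPascal_eq_zero (show n + 1 < k + 1 by omega),
        qPascal_eq_zero (show n < k + 1 by omega)]

theorem succ_mul_self_div_two (m : ℕ) :
    (m + 1) * (m + 1 - 1) / 2 = m * (m - 1) / 2 + m := by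
  rw [← Nat.triangle_succ]

/-- The sum telescopes: by the second Pascal rule, and because consecutive triangular numbers differ
by `m`, each summand is a difference `g (j + 1) - g j`. -/
theorem sum_neg_one_pow_mul_qPascal (n : ℕ) :
    ∑ j ∈ Finset.range (n + 1), (-1) ^ (n - j) * X ^ ((n - j) * (n - j - 1) / 2) * qPascal n j =
      if n = 0 then 1 else 0 := by
  cases n with
  | zero => simp [qPascal_zero_right]
  | succ n =>
    rw [if_neg n.succ_ne_zero]
    set g : ℕ → ℤ[X] := fun j =>
      (-1) ^ (n + 1 - j) * X ^ ((n + 1 - j) * (n + 1 - j - 1) / 2) * qPascal n j with hg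
    have h1 : ∀ j ∈ Finset.range (n + 1),
        (-1) ^ (n + 1 - (j + 1)) * X ^ ((n + 1 - (j + 1)) * (n + 1 - (j + 1) - 1) / 2) *
          qPascal (n + 1) (j + 1) = g (j + 1) - g j := by
      intro j hj
      have hj' : j ≤ n := by simpa [Nat.lt_succ_iff] using hj
      obtain ⟨m, rfl⟩ := Nat.exists_eq_add_of_le hj'
      simp only [hg]
      rw [qPascal_succ_succ', show j + m + 1 - (j + 1) = m by omega,
        show j + m + 1 - j = m + 1 by omega, show j + m - j = m by omega,
        succ_mul_self_div_two, pow_add, pow_succ]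
      ring
    rw [Finset.sum_range_succ', Finset.sum_congr rfl h1, Finset.sum_range_sub, hg]
    simp [qPascal_zero_right, qPascal_eq_zero]

/-- The coefficient of `(pj choose i)_u` in `A_{n,i}`. -/
def altCoeff (p n j : ℕ) : ℤ[X] :=
  (-1) ^ (n - j) * X ^ (p * ((n - j) * (n - j - 1) / 2)) * expand ℤ p (qPascal n j)

theorem polyA_eq (p n i : ℕ) :
    polyA p n i = ∑ j ∈ Finset.range (n + 1), altCoeff p n j * qPascal (p * j) i := by
  simp only [polyA, altCoeff, qBinom_eq_qPascal]

theorem polyA_zero_left (p i : ℕ) : polyA p 0 i = if i = 0 then 1 else 0 := by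
  rw [polyA_eq]
  cases i with
  | zero => simp [altCoeff, qPascal_zero_right]
  | succ i => simp [qPascal_eq_zero]

theorem polyA_zero_right (p n : ℕ) : polyA p n 0 = if n = 0 then 1 else 0 := by
  have h := congrArg (expand ℤ p) (sum_neg_one_pow_mul_qPascal n)
  rw [polyA_eq]
  simp only [map_sum, map_mul, map_pow, map_neg, map_one, expand_X, ← pow_mul] at h
  simp only [qPascal_zero_right, altCoeff, mul_one]
  rw [h]
  split_ifs <;> simp

/-- The relation between the q-binomials of orders k and k + 1, taken at `u ^ p`; multiplying by
`(p)_u` turns `(m)_{u^p}` into `(pm)_u`. -/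
theorem altCoeff_succ_mul {p k j : ℕ} (h : j ≤ k) :
    altCoeff p (k + 1) j * qInt (p * (k + 1 - j)) =
      -(qInt (p * (k + 1)) * X ^ (p * (k - j)) * altCoeff p k j) := by
  have h1 := congrArg (expand ℤ p) (qPascal_succ_mul_qInt h)
  rw [map_mul, map_mul] at h1
  obtain ⟨m, rfl⟩ := Nat.exists_eq_add_of_le h
  simp only [altCoeff]
  rw [show j + m + 1 - j = m + 1 by omega] at *
  rw [show j + m - j = m by omega, qInt_mul, qInt_mul, succ_mul_self_div_two, mul_add p, pow_add,
    pow_succ]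
  linear_combination (-(-1) ^ m * X ^ (p * (m * (m - 1) / 2)) * X ^ (p * m) * qInt p) * h1

/-- This holds summand by summand. First `(n+1)_u` lowers the q-binomial, leaving the factor
`(pj-n)_u`; then `(p(k+1)-n)_u` splits as `(pj-n)_u + u^(pj-n) (p(k+1-j))_u`, and
`altCoeff_succ_mul` absorbs the last factor. Truncated subtraction does no harm, since the summand
vanishes when `pj < n`. Only j = k + 1 is missing in `A_{k,n}`, and there the two remaining terms
agree. -/
theorem qInt_succ_mul_polyA (p k n : ℕ) :
    qInt (n + 1) * polyA p (k + 1) (n + 1) =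
      qInt (p * (k + 1)) * X ^ (p * k - n) * polyA p k n +
        qInt (p * (k + 1) - n) * polyA p (k + 1) n := by
  have key : ∀ j ∈ Finset.range (k + 1),
      altCoeff p (k + 1) j * (qInt (n + 1) * qPascal (p * j) (n + 1)) =
        qInt (p * (k + 1)) * X ^ (p * k - n) * (altCoeff p k j * qPascal (p * j) n) +
          qInt (p * (k + 1) - n) * (altCoeff p (k + 1) j * qPascal (p * j) n) := by
    intro j hj
    have hj' : j ≤ k := by simpa [Nat.lt_succ_iff] using hj
    rw [qInt_mul_qPascal_succ]
    rcases lt_or_ge (p * j) n with h | h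
    · rw [qPascal_eq_zero h]; ring
    · have h1 := altCoeff_succ_mul (p := p) hj'
      obtain ⟨m, rfl⟩ := Nat.exists_eq_add_of_le hj'
      have h2 : p * (j + m + 1) - n = (p * j - n) + p * (j + m + 1 - j) := by
        rw [show j + m + 1 - j = m + 1 by omega, show p * (j + m + 1) = p * j + p * (m + 1) by ring]
        omega
      have h3 : p * (j + m) - n = (p * j - n) + p * (j + m - j) := by
        rw [show j + m - j = m by omega, mul_add]; omega
      rw [h2, h3, qInt_add (p * j - n), pow_add]
      linear_combination (-X ^ (p * j - n) * qPascal (p * j) n) * h1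
  rw [polyA_eq, polyA_eq, polyA_eq, Finset.sum_range_succ _ (k + 1), Finset.sum_range_succ _ (k + 1),
    mul_add (qInt (n + 1)), mul_add (qInt (p * (k + 1) - n)), Finset.mul_sum, Finset.mul_sum,
    Finset.mul_sum, ← add_assoc,
    ← Finset.sum_add_distrib]
  congr 1
  · exact Finset.sum_congr rfl fun j hj => by rw [← key j hj]; ring
  · rw [mul_left_comm, qInt_mul_qPascal_succ]; ring

/-- The polynomials `B_{k,n}`, by recursion on `n`. -/
def divFrob (p : ℕ) : ℕ → ℕ → ℤ[X]
  | 0, 0 => 1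
  | 0, _ + 1 => 0
  | _ + 1, 0 => 0
  | n + 1, k + 1 =>
    X ^ (p * k - n) * divFrob p n k + qInt (p * (k + 1) - n) * divFrob p n (k + 1)

theorem divFrob_zero_left (p k : ℕ) : divFrob p 0 k = if k = 0 then 1 else 0 := by
  cases k <;> simp [divFrob]

theorem divFrob_succ_zero (p n : ℕ) : divFrob p (n + 1) 0 = 0 := by rw [divFrob]

theorem divFrob_succ_succ (p n k : ℕ) : divFrob p (n + 1) (k + 1) =
    X ^ (p * k - n) * divFrob p n k + qInt (p * (k + 1) - n) * divFrob p n (k + 1) := by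
  rw [divFrob]

/-- Clearing denominators turns the recursion for `A` into the one defining `divFrob`. This also
proves that the division in `polyB` is exact. -/
theorem qFactorial_mul_polyA (p k n : ℕ) :
    qFactorial n * polyA p k n = expand ℤ p (qFactorial k) * qInt p ^ k * divFrob p n k := by
  induction n generalizing k with
  | zero =>
    rw [polyA_zero_right, divFrob_zero_left, qFactorial_zero]
    split_ifs with h
    · simp [h, qFactorial_zero]
    · simp
  | succ n ih =>
    cases k with
    | zero => rw [divFrob_succ_zero, polyA_zero_left, if_neg n.succ_ne_zero]; simp
    | succ k =>
      have h1 := qInt_succ_mul_polyA p k n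
      have h2 := ih k
      have h3 := ih (k + 1)
      rw [divFrob_succ_succ, qFactorial_succ, mul_assoc, h1, qInt_mul]
      rw [qFactorial_succ k, map_mul] at *
      linear_combination (qInt p * expand ℤ p (qInt (k + 1)) * X ^ (p * k - n)) * h2 +
        qInt (p * (k + 1) - n) * h3

theorem polyB_eq_divFrob {p : ℕ} (hp : p ≠ 0) (k n : ℕ) : polyB p k n = divFrob p n k := by
  unfold polyB
  rw [qFactorial_mul_polyA]
  exact mul_divByMonic_cancel_left _
    (((qFactorial_monic k).expand hp.bot_lt).mul ((qInt_monic hp).pow k))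

theorem divFrob_eq_zero {p n k : ℕ} (h : n < k) : divFrob p n k = 0 := by
  induction n generalizing k with
  | zero => rw [divFrob_zero_left, if_neg h.ne']
  | succ n ih =>
    obtain ⟨k, rfl⟩ := Nat.exists_eq_succ_of_ne_zero (Nat.ne_zero_of_lt h)
    rw [Nat.succ_eq_add_one, divFrob_succ_succ, ih (by omega), ih (by omega)]; simp

theorem divFrob_eq_zero_of_mul_lt {p n k : ℕ} (hp : p ≠ 0) (h : p * k < n) :
    divFrob p n k = 0 := by
  induction n generalizing k with
  | zero => omega
  | succ n ih =>
    cases k with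
    | zero => rw [divFrob_succ_zero]
    | succ k =>
      rw [divFrob_succ_succ, Nat.sub_eq_zero_of_le (Nat.lt_succ_iff.1 h), qInt_zero,
        ih (by rw [mul_add] at h; omega)]
      simp

/-! ### Specialisation at `q` -/

section Specialisation

variable {R : Type*} [CommRing R] {q : R} {p : ℕ}

theorem aeval_qInt_mul_eq_zero (hq : aeval q (qInt p) = 0) (l : ℕ) :
    aeval q (qInt (p * l)) = 0 := by
  rw [qInt_mul, map_mul, hq, zero_mul]

/-- If `km = 1 + pl`, then `(k)_q (m)_{q^k} = (km)_q = 1 + q (pl)_q = 1`. -/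
theorem isUnit_aeval_qInt (hp : p.Prime) (hq : aeval q (qInt p) = 0) {k : ℕ} (hk : ¬ p ∣ k) :
    IsUnit (aeval q (qInt k)) := by
  have hc : Nat.Coprime k p := ((hp.coprime_iff_not_dvd).2 hk).symm
  obtain ⟨m, -, hm⟩ := Nat.exists_mul_mod_eq_one_of_coprime hc hp.one_lt
  have h : k * m = 1 + p * (k * m / p) := by
    conv_lhs => rw [← Nat.mod_add_div (k * m) p, hm]
  have h1 : aeval q (qInt (k * m)) = 1 := by
    rw [h, qInt_add, map_add, map_mul, aeval_qInt_mul_eq_zero hq, qInt_one]; simp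
  rw [qInt_mul, map_mul] at h1
  exact IsUnit.of_mul_eq_one _ h1

theorem isUnit_aeval_qFactorial (hp : p.Prime) (hq : aeval q (qInt p) = 0) {k : ℕ} (hk : k < p) :
    IsUnit (aeval q (qFactorial k)) := by
  induction k with
  | zero => rw [qFactorial_zero]; simp
  | succ k ih =>
    rw [qFactorial_succ, map_mul]
    exact (ih (by omega)).mul
      (isUnit_aeval_qInt hp hq fun h => absurd (Nat.le_of_dvd (Nat.succ_pos k) h) (by omega))

/-- For k = 1 the recursion gives the product `(p-1)_q (p-2)_q ⋯ (p-n)_q`, none of whose indices is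
divisible by p. -/
theorem isUnit_aeval_divFrob_one (hp : p.Prime) (hq : aeval q (qInt p) = 0) {n : ℕ}
    (hn : n < p) : IsUnit (aeval q (divFrob p (n + 1) 1)) := by
  induction n with
  | zero => rw [divFrob_succ_succ]; simp [divFrob_zero_left]
  | succ n ih =>
    rw [divFrob_succ_succ, divFrob_succ_zero, mul_zero, zero_add, map_mul]
    refine (isUnit_aeval_qInt hp hq fun h => ?_).mul (ih (by omega))
    exact absurd (Nat.le_of_dvd (by omega) h) (by omega)

theorem pow_eq_one_of_aeval_qInt (hq : aeval q (qInt p) = 0) : q ^ p = 1 := by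
  have h := qInt_add p 1
  rw [add_comm, qInt_add, qInt_one] at h
  have := congrArg (aeval q) h
  simpa [hq] using this.symm

/-- In `(p choose k)_q (k)_q! (p-k)_q! = (p)_q! = 0` both lower factorials are units. -/
theorem aeval_qPascal_prime (hp : p.Prime) (hq : aeval q (qInt p) = 0) {k : ℕ} (h0 : 0 < k)
    (hk : k < p) : aeval q (qPascal p k) = 0 := by
  have h := qPascal_add_mul k (p - k)
  obtain ⟨m, hm⟩ := Nat.exists_eq_succ_of_ne_zero hp.ne_zero
  rw [Nat.add_sub_cancel' hk.le] at h
  have h1 : aeval q (qFactorial p) = 0 := by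
    rw [hm, Nat.succ_eq_add_one, qFactorial_succ, map_mul, ← Nat.succ_eq_add_one, ← hm, hq,
      mul_zero]
  rw [← h, map_mul, map_mul] at h1
  exact (((isUnit_aeval_qFactorial hp hq hk).mul
    (isUnit_aeval_qFactorial hp hq (show p - k < p by omega))).mul_left_eq_zero).1 h1

end Specialisation

/-! ### Completion with respect to a regular central element -/

section CompletionLemmas

variable {D : Type*} [Ring D] {t : D}

theorem mem_span_singleton_iff_dvd (ht : ∀ b, t * b = b * t) {b : D} :
    b ∈ TwoSidedIdeal.span {t} ↔ t ∣ b := by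
  constructor
  · intro hb
    let I : TwoSidedIdeal D := TwoSidedIdeal.mk' {b | t ∣ b} (dvd_zero t) dvd_add
      (fun h => (dvd_neg).2 h) (fun {x y} ⟨c, hc⟩ => ⟨x * c, by rw [hc, ← mul_assoc, ← ht, mul_assoc]⟩)
      (fun {x y} ⟨c, hc⟩ => ⟨c * y, by rw [hc, mul_assoc]⟩)
    have hI : TwoSidedIdeal.span {t} ≤ I := by
      rw [TwoSidedIdeal.span_le]
      rintro _ rfl
      simp [I]
    simpa [I] using hI hb
  · rintro ⟨c, rfl⟩
    exact TwoSidedIdeal.mul_mem_right _ _ _ (TwoSidedIdeal.subset_span rfl)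

theorem coe_eq_coe_iff_pow_dvd (ht : ∀ b, t * b = b * t) {n : ℕ} {a b : D} :
    (a : (TwoSidedIdeal.span {t ^ n}).ringCon.Quotient) = b ↔ t ^ n ∣ a - b := by
  have ht' : ∀ b, t ^ n * b = b * t ^ n := fun b => (Commute.pow_left (ht b) n)
  rw [RingCon.eq, TwoSidedIdeal.rel_iff, mem_span_singleton_iff_dvd ht']

theorem Completion.exists_rep (s : Completion D t) (n : ℕ) :
    ∃ b : D, (b : (TwoSidedIdeal.span {t ^ n}).ringCon.Quotient) = s.1 n := by
  obtain ⟨b, hb, -⟩ := s.2 n n le_rfl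
  exact ⟨b, hb⟩

/-- A representative modulo `t ^ n` of an element of the completion. -/
def Completion.rep (s : Completion D t) (n : ℕ) : D := (Completion.exists_rep s n).choose

theorem Completion.coe_rep (s : Completion D t) (n : ℕ) :
    ((Completion.rep s n : D) : (TwoSidedIdeal.span {t ^ n}).ringCon.Quotient) = s.1 n :=
  (Completion.exists_rep s n).choose_spec

theorem Completion.coe_rep_of_le (ht : ∀ b, t * b = b * t) (s : Completion D t) {m n : ℕ}
    (h : m ≤ n) : ((Completion.rep s n : D) : (TwoSidedIdeal.span {t ^ m}).ringCon.Quotient) = s.1 m := by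
  obtain ⟨b, hb, hb'⟩ := s.2 m n h
  rw [← hb', coe_eq_coe_iff_pow_dvd ht]
  refine (pow_dvd_pow t h).trans ?_
  rw [← coe_eq_coe_iff_pow_dvd ht, hb, Completion.coe_rep]

/-- A sequence that is Cauchy for the `t`-adic topology defines an element of the completion. -/
def Completion.mk (ht : ∀ b, t * b = b * t) (b : ℕ → D)
    (hb : ∀ m n, m ≤ n → t ^ m ∣ b n - b m) : Completion D t :=
  ⟨fun n => (b n : (TwoSidedIdeal.span {t ^ n}).ringCon.Quotient),
    fun m n h => ⟨b n, rfl, (coe_eq_coe_iff_pow_dvd ht).2 (hb m n h)⟩⟩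

/-- Elements of the completion that vanish modulo `t ^ n` are divisible by `t ^ n`. -/
theorem Completion.exists_eq_pow_mul (ht : ∀ b, t * b = b * t) (hreg : ∀ b, t * b = 0 → b = 0)
    (s : Completion D t) (n : ℕ) (hs : s.1 n = 0) :
    ∃ s' : Completion D t, s = Completion.of t t ^ n * s' := by
  have hregn : ∀ (n : ℕ) b, t ^ n * b = 0 → b = 0 := by
    intro n
    induction n with
    | zero => intro b hb; simpa using hb
    | succ n ih => intro b hb; rw [pow_succ', mul_assoc] at hb; exact ih _ (hreg _ hb)
  -- Precision n is lost on dividing by `t ^ n`, so the quotient modulo `t ^ m` is read off from a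
  -- representative modulo `t ^ (n + m)`.
  have h1 : ∀ m, ∃ b, Completion.rep s (n + m) = t ^ n * b := by
    intro m
    have h := Completion.coe_rep_of_le ht s (Nat.le_add_right n m)
    rw [hs, ← RingCon.coe_zero, coe_eq_coe_iff_pow_dvd ht, sub_zero] at h
    exact h
  choose b hb using h1
  refine ⟨Completion.mk ht b ?_, ?_⟩
  · intro m k hmk
    have h : ((Completion.rep s (n + k) : D) : (TwoSidedIdeal.span {t ^ (n + m)}).ringCon.Quotient) =
        (Completion.rep s (n + m) : D) := by
      rw [Completion.coe_rep_of_le ht s (by omega), Completion.coe_rep]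
    rw [coe_eq_coe_iff_pow_dvd ht, hb, hb, ← mul_sub] at h
    obtain ⟨c, hc⟩ := h
    refine ⟨c, ?_⟩
    rw [pow_add, mul_assoc, ← sub_eq_zero, ← mul_sub] at hc
    exact sub_eq_zero.1 (hregn n _ hc)
  · refine Subtype.ext (funext fun m => ?_)
    have h : s.1 m = ((t ^ n * b m : D) : (TwoSidedIdeal.span {t ^ m}).ringCon.Quotient) := by
      rw [← hb, Completion.coe_rep_of_le ht s (by omega)]
    rw [h, RingCon.coe_mul, RingCon.coe_pow]
    rfl

end CompletionLemmas

/-! ### Completed endomorphism rings -/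

section AdicLemmas

variable {Z : Type*} [CommRing Z] {θ : Z} {N : Type*} [AddCommGroup N] [Module Z N]

theorem mem_span_pow_smul_top {M : Type*} [AddCommGroup M] [Module Z M] {n : ℕ} {y : M} :
    y ∈ (Ideal.span {θ} ^ n • ⊤ : Submodule Z M) ↔ ∃ z, y = θ ^ n • z := by
  rw [Ideal.span_singleton_pow, Submodule.ideal_span_singleton_smul,
    Submodule.mem_smul_pointwise_iff_exists]
  simp [eq_comm]

theorem adicCompletion_exists_eq (y : AdicCompletion (Ideal.span {θ}) N) (n : ℕ) :
    ∃ (z : N) (y' : AdicCompletion (Ideal.span {θ}) N),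
      y = AdicCompletion.of _ _ z + θ ^ n • y' := by
  obtain ⟨z, hz⟩ := Submodule.mkQ_surjective _ (AdicCompletion.eval (Ideal.span {θ}) N n y)
  have h : y - AdicCompletion.of _ _ z ∈
      (AdicCompletion.eval (Ideal.span {θ}) N n).ker := by
    rw [LinearMap.mem_ker, map_sub, AdicCompletion.eval_of, hz, sub_self]
  rw [← AdicCompletion.pow_smul_top_eq_ker_eval ⟨{θ}, by simp⟩, mem_span_pow_smul_top] at h
  obtain ⟨y', hy'⟩ := h
  exact ⟨z, y', by rw [← hy']; abel⟩

theorem adicCompletion_eval_pow_smul (y : AdicCompletion (Ideal.span {θ}) N) (n : ℕ) :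
    AdicCompletion.eval _ _ n (θ ^ n • y) = 0 := by
  have : θ ^ n • y ∈ (AdicCompletion.eval (Ideal.span {θ}) N n).ker :=
    AdicCompletion.pow_smul_top_le_ker_eval _ _ (mem_span_pow_smul_top.2 ⟨y, rfl⟩)
  exact this

/-- Linearity forces continuity: `F` maps multiples of `θ ^ n` to multiples of `θ ^ n`, and N is
dense. -/
theorem adicCompletion_end_eval_congr
    (F G : Module.End (AdicCompletion (Ideal.span {θ}) Z) (AdicCompletion (Ideal.span {θ}) N))
    (n : ℕ) (h : ∀ z : N, AdicCompletion.eval _ _ n (F (AdicCompletion.of _ _ z)) =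
      AdicCompletion.eval _ _ n (G (AdicCompletion.of _ _ z)))
    (y : AdicCompletion (Ideal.span {θ}) N) :
    AdicCompletion.eval _ _ n (F y) = AdicCompletion.eval _ _ n (G y) := by
  obtain ⟨z, y', rfl⟩ := adicCompletion_exists_eq y n
  have hF : ∀ F : Module.End (AdicCompletion (Ideal.span {θ}) Z)
      (AdicCompletion (Ideal.span {θ}) N), F (θ ^ n • y') = θ ^ n • F y' := fun F =>
    (F.restrictScalars Z).map_smul _ _
  rw [map_add, map_add, map_add, map_add, hF, hF, adicCompletion_eval_pow_smul,
    adicCompletion_eval_pow_smul, h]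

theorem adicCompletion_end_ext
    {F G : Module.End (AdicCompletion (Ideal.span {θ}) Z) (AdicCompletion (Ideal.span {θ}) N)}
    (h : ∀ z : N, F (AdicCompletion.of _ _ z) = G (AdicCompletion.of _ _ z)) : F = G := by
  refine LinearMap.ext fun y => AdicCompletion.ext fun n => ?_
  exact adicCompletion_end_eval_congr F G n (fun z => by rw [h]) y

/-- Without θ-torsion, pointwise quotients by `θ ^ n` are unique and therefore depend linearly on
the argument. -/
theorem exists_eq_smul_of_range (hN : ∀ z : N, θ • z = 0 → z = 0) (n : ℕ) (T : Module.End Z N)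
    (hT : ∀ z, ∃ y, T z = θ ^ n • y) : ∃ T' : Module.End Z N, T = θ ^ n • T' := by
  have hreg : ∀ (n : ℕ) (z : N), θ ^ n • z = 0 → z = 0 := by
    intro n
    induction n with
    | zero => intro b hb; simpa using hb
    | succ n ih => intro b hb; rw [pow_succ', mul_smul] at hb; exact ih _ (hN _ hb)
  have hinj : ∀ y z : N, θ ^ n • y = θ ^ n • z → y = z := fun y z h =>
    sub_eq_zero.1 (hreg n _ (by rw [smul_sub, h, sub_self]))
  choose S hS using hT
  refine ⟨{ toFun := S, map_add' := fun y z => hinj _ _ ?_, map_smul' := fun c z => hinj _ _ ?_ },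
    LinearMap.ext hS⟩
  · rw [← hS, map_add, hS, hS, smul_add]
  · rw [← hS, map_smul, hS, smul_comm]; rfl

end AdicLemmas

/-! ### Lifting a comparison modulo θ to the completions -/

section EndComparison

variable {Z : Type*} [CommRing Z] {θ : Z} {N : Type*} [AddCommGroup N] [Module Z N]
  {D : Type*} [Ring D] {t : D} (L : D →+* Module.End Z N)

/-- Approximation data for a ring homomorphism `L : D → End_Z(N)`: modulo `θ` the map `L` is
bijective, and it carries the regular central element `t` to `θ` times a unit modulo `θ`. -/
structure IsAdicEquiv (θ : Z) (t : D) : Prop where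
  comm : ∀ b, t * b = b * t
  regular : ∀ b, t * b = 0 → b = 0
  torsionFree : ∀ z : N, θ • z = 0 → z = 0
  map_t : ∃ (c : Z) (S : Module.End Z N), IsUnit c ∧ L t = θ • (c • 1 + θ • S)
  surj : ∀ T : Module.End Z N, ∃ (P : D) (T' : Module.End Z N), T = L P + θ • T'
  inj : ∀ (P : D) (T' : Module.End Z N), L P = θ • T' → t ∣ P

variable {L}

namespace IsAdicEquiv

theorem map_pow (h : IsAdicEquiv L θ t) (n : ℕ) :
    ∃ (c : Z) (S : Module.End Z N), IsUnit c ∧ L (t ^ n) = θ ^ n • (c • 1 + θ • S) := by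
  obtain ⟨c, S, hc, hL⟩ := h.map_t
  have h1 : ∀ n : ℕ, ∃ S' : Module.End Z N, (c • 1 + θ • S) ^ n = c ^ n • 1 + θ • S' := by
    intro n
    induction n with
    | zero => exact ⟨0, by simp⟩
    | succ n ih =>
      obtain ⟨S', hS'⟩ := ih
      refine ⟨c ^ n • S + c • S' + θ • (S' * S), ?_⟩
      rw [pow_succ, hS']
      simp only [add_mul, mul_add, smul_mul_assoc, mul_smul_comm, one_mul, mul_one, smul_smul,
        smul_add]
      module
  obtain ⟨S', hS'⟩ := h1 n
  exact ⟨c ^ n, S', hc.pow n, by rw [_root_.map_pow, hL, _root_.smul_pow, hS']⟩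

theorem cancel (h : IsAdicEquiv L θ t) (n : ℕ) {S T : Module.End Z N}
    (hST : θ ^ n • S = θ ^ n • T) : S = T := by
  have hreg : ∀ (n : ℕ) (z : N), θ ^ n • z = 0 → z = 0 := by
    intro n
    induction n with
    | zero => intro b hb; simpa using hb
    | succ n ih => intro b hb; rw [pow_succ', mul_smul] at hb; exact ih _ (h.torsionFree _ hb)
  refine LinearMap.ext fun z => sub_eq_zero.1 (hreg n _ ?_)
  rw [smul_sub, sub_eq_zero]
  exact LinearMap.congr_fun hST z

theorem surj_pow (h : IsAdicEquiv L θ t) (T : Module.End Z N) (n : ℕ) :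
    ∃ (P : D) (T' : Module.End Z N), T = L P + θ ^ n • T' := by
  induction n with
  | zero => exact ⟨0, T, by simp⟩
  | succ n ih =>
    obtain ⟨P, T', rfl⟩ := ih
    obtain ⟨c, S, ⟨u, rfl⟩, hL⟩ := h.map_pow n
    -- `L (t ^ n)` is `u θ ^ n` to leading order, so the error `θ ^ n T'` is cancelled by `t ^ n
    -- P'`, where `P'` approximates `u⁻¹ T'`.
    obtain ⟨P', T'', hP'⟩ := h.surj ((↑u⁻¹ : Z) • T')
    refine ⟨P + t ^ n * P', (u : Z) • T'' - S * L P', ?_⟩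
    have h1 : T' = (u : Z) • L P' + (u : Z) • θ • T'' := by
      rw [← smul_add, ← hP', smul_smul, Units.mul_inv, one_smul]
    rw [map_add, map_mul, hL, h1]
    simp only [add_mul, smul_mul_assoc, one_mul, pow_succ]
    module

/-- Induction on n: after writing `P = t ^ n P'` and cancelling `θ ^ n`, the unit `u` can be divided
out to see that `L P'` is divisible by θ. -/
theorem inj_pow (h : IsAdicEquiv L θ t) (P : D) (n : ℕ) (T : Module.End Z N)
    (hP : L P = θ ^ n • T) : t ^ n ∣ P := by
  induction n generalizing T with
  | zero => simp
  | succ n ih =>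
    obtain ⟨P', rfl⟩ := ih (θ • T) (by rw [hP, pow_succ, mul_smul])
    obtain ⟨c, S, ⟨u, rfl⟩, hL⟩ := h.map_pow n
    rw [map_mul, hL, smul_mul_assoc, pow_succ, mul_smul] at hP
    have h1 := h.cancel n hP
    rw [pow_succ]
    refine mul_dvd_mul_left _ (h.inj P' ((↑u⁻¹ : Z) • (T - S * L P')) ?_)
    have h2 : (u : Z) • L P' = θ • (T - S * L P') := by
      rw [smul_sub, ← h1]
      simp only [add_mul, smul_mul_assoc, one_mul]
      abel
    rw [smul_comm, ← h2, smul_smul, Units.inv_mul, one_smul]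

theorem exists_map_eq_of_dvd (h : IsAdicEquiv L θ t) {n : ℕ} {P Q : D} (hPQ : t ^ n ∣ P - Q)
    (z : N) : ∃ y, L P z = L Q z + θ ^ n • y := by
  obtain ⟨c, hc⟩ := hPQ
  obtain ⟨u, S, -, hL⟩ := h.map_pow n
  refine ⟨(u • 1 + θ • S) (L c z), ?_⟩
  have h1 : L P - L Q = θ ^ n • ((u • 1 + θ • S) * L c) := by
    rw [← map_sub, hc, map_mul, hL, smul_mul_assoc]
  rw [← sub_eq_iff_eq_add', ← LinearMap.sub_apply, h1]
  rfl

theorem reduceModIdeal_congr (h : IsAdicEquiv L θ t) {n : ℕ} {P Q : D} (hPQ : t ^ n ∣ P - Q) :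
    (L P).reduceModIdeal (Ideal.span {θ} ^ n) = (L Q).reduceModIdeal (Ideal.span {θ} ^ n) := by
  refine LinearMap.ext fun y => ?_
  obtain ⟨z, rfl⟩ := Submodule.Quotient.mk_surjective _ y
  rw [LinearMap.reduceModIdeal_apply, LinearMap.reduceModIdeal_apply, Submodule.Quotient.eq,
    mem_span_pow_smul_top]
  obtain ⟨y, hy⟩ := h.exists_map_eq_of_dvd hPQ z
  exact ⟨y, by rw [hy]; abel⟩

/-- The endomorphism of the completion of `N` given by an element of the completion of `D`. -/
def toEndFun (h : IsAdicEquiv L θ t) (s : Completion D t) :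
    Module.End (AdicCompletion (Ideal.span {θ}) Z) (AdicCompletion (Ideal.span {θ}) N) where
  __ := AdicCompletion.lift (Ideal.span {θ})
    (fun n => (L (Completion.rep s n)).reduceModIdeal (Ideal.span {θ} ^ n) ∘ₗ
      AdicCompletion.eval (Ideal.span {θ}) N n)
    (fun {m n} hmn => by
      have h1 : (L (Completion.rep s m)).reduceModIdeal (Ideal.span {θ} ^ m) =
          (L (Completion.rep s n)).reduceModIdeal (Ideal.span {θ} ^ m) := by
        apply h.reduceModIdeal_congr
        rw [← coe_eq_coe_iff_pow_dvd h.comm, Completion.coe_rep,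
          Completion.coe_rep_of_le h.comm s hmn]
      rw [h1, ← LinearMap.comp_assoc, AdicCompletion.transitionMap_comp_reduceModIdeal,
        LinearMap.comp_assoc, AdicCompletion.transitionMap_comp_eval])
  map_smul' r x := by
    ext
    dsimp
    rw [AdicCompletion.val_smul_eq_evalₐ_smul, AdicCompletion.val_smul_eq_evalₐ_smul, map_smul]

theorem toEndFun_val (h : IsAdicEquiv L θ t) (s : Completion D t)
    (y : AdicCompletion (Ideal.span {θ}) N) (n : ℕ) (P : D)
    (hP : (P : (TwoSidedIdeal.span {t ^ n}).ringCon.Quotient) = s.1 n) :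
    (h.toEndFun s y).val n = (L P).reduceModIdeal (Ideal.span {θ} ^ n) (y.val n) := by
  have h1 : (L P).reduceModIdeal (Ideal.span {θ} ^ n) =
      (L (Completion.rep s n)).reduceModIdeal (Ideal.span {θ} ^ n) := by
    apply h.reduceModIdeal_congr
    rw [← coe_eq_coe_iff_pow_dvd h.comm, Completion.coe_rep, hP]
  rw [h1]
  rfl

/-- The ring homomorphism from the completion of `D` to the endomorphisms of the completion
of `N`. -/
def toEnd (h : IsAdicEquiv L θ t) : Completion D t →+*
    Module.End (AdicCompletion (Ideal.span {θ}) Z) (AdicCompletion (Ideal.span {θ}) N) where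
  toFun := h.toEndFun
  map_one' := by
    refine LinearMap.ext fun y => AdicCompletion.ext fun n => ?_
    rw [h.toEndFun_val 1 y n 1 rfl, map_one]
    obtain ⟨z, hz⟩ := Submodule.Quotient.mk_surjective _ (y.val n)
    rw [← hz, LinearMap.reduceModIdeal_apply, Module.End.one_apply, Module.End.one_apply, hz]
  map_zero' := by
    refine LinearMap.ext fun y => AdicCompletion.ext fun n => ?_
    rw [h.toEndFun_val 0 y n 0 rfl, map_zero]
    obtain ⟨z, hz⟩ := Submodule.Quotient.mk_surjective _ (y.val n)
    rw [← hz, LinearMap.reduceModIdeal_apply]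
    rfl
  map_add' s r := by
    refine LinearMap.ext fun y => AdicCompletion.ext fun n => ?_
    rw [LinearMap.add_apply, AdicCompletion.val_add_apply,
      h.toEndFun_val (s + r) y n (Completion.rep s n + Completion.rep r n)
        (by rw [RingCon.coe_add, Completion.coe_rep, Completion.coe_rep]; rfl),
      h.toEndFun_val s y n _ (Completion.coe_rep s n),
      h.toEndFun_val r y n _ (Completion.coe_rep r n), map_add]
    obtain ⟨z, hz⟩ := Submodule.Quotient.mk_surjective _ (y.val n)
    rw [← hz, LinearMap.reduceModIdeal_apply, LinearMap.reduceModIdeal_apply,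
      LinearMap.reduceModIdeal_apply]
    rfl
  map_mul' s r := by
    refine LinearMap.ext fun y => AdicCompletion.ext fun n => ?_
    rw [Module.End.mul_apply,
      h.toEndFun_val (s * r) y n (Completion.rep s n * Completion.rep r n)
        (by rw [RingCon.coe_mul, Completion.coe_rep, Completion.coe_rep]; rfl),
      h.toEndFun_val s _ n _ (Completion.coe_rep s n),
      h.toEndFun_val r y n _ (Completion.coe_rep r n), map_mul]
    obtain ⟨z, hz⟩ := Submodule.Quotient.mk_surjective _ (y.val n)
    rw [← hz, LinearMap.reduceModIdeal_apply, LinearMap.reduceModIdeal_apply,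
      LinearMap.reduceModIdeal_apply]
    rfl

theorem toEnd_of (h : IsAdicEquiv L θ t) (P : D) :
    h.toEnd (Completion.of t P) = AdicCompletion.map _ (L P) :=
  LinearMap.ext fun y => AdicCompletion.ext fun n => h.toEndFun_val _ y n P rfl

theorem toEnd_of_apply_of (h : IsAdicEquiv L θ t) (s : Completion D t) (n : ℕ) (P : D)
    (hP : (P : (TwoSidedIdeal.span {t ^ n}).ringCon.Quotient) = s.1 n) (z : N) :
    AdicCompletion.eval _ _ n (h.toEnd s (AdicCompletion.of _ _ z)) =
      Submodule.mkQ _ (L P z) :=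
  h.toEndFun_val s _ n P hP

/-- If s acts as zero, a representative modulo `t ^ n` maps N into `θ ^ n N`, so `inj_pow` makes it
divisible by `t ^ n`. -/
theorem toEnd_injective (h : IsAdicEquiv L θ t) : Function.Injective h.toEnd := by
  rw [injective_iff_map_eq_zero]
  intro s hs
  refine Subtype.ext (funext fun n => ?_)
  rw [← Completion.coe_rep s n]
  change _ = ((0 : D) : (TwoSidedIdeal.span {t ^ n}).ringCon.Quotient)
  rw [coe_eq_coe_iff_pow_dvd h.comm, sub_zero]
  have h1 : ∀ z, ∃ y, L (Completion.rep s n) z = θ ^ n • y := by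
    intro z
    have h2 := h.toEnd_of_apply_of s n _ (Completion.coe_rep s n) z
    rw [hs, LinearMap.zero_apply, map_zero, eq_comm, Submodule.mkQ_apply,
      Submodule.Quotient.mk_eq_zero, mem_span_pow_smul_top] at h2
    exact h2
  obtain ⟨T, hT⟩ := exists_eq_smul_of_range h.torsionFree n _ h1
  exact h.inj_pow _ n T hT

/-- Projectivity lifts the reduction of `F` modulo `θ ^ n` to an endomorphism of N, which `surj_pow`
approximates by some `L (P n)`. By `inj_pow` the `P n` form a Cauchy sequence, whose limit acts as
`F`. -/
theorem toEnd_surjective [Module.Projective Z N] (h : IsAdicEquiv L θ t) :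
    Function.Surjective h.toEnd := by
  intro F
  have h1 : ∀ n, ∃ P : D, ∀ z, AdicCompletion.eval _ _ n (F (AdicCompletion.of _ _ z)) =
      Submodule.mkQ _ (L P z) := by
    intro n
    obtain ⟨T, hT⟩ := Module.projective_lifting_property
      (Submodule.mkQ (Ideal.span {θ} ^ n • ⊤ : Submodule Z N))
      (AdicCompletion.eval (Ideal.span {θ}) N n ∘ₗ F.restrictScalars Z ∘ₗ
        AdicCompletion.of (Ideal.span {θ}) N) (Submodule.mkQ_surjective _)
    obtain ⟨P, T', rfl⟩ := h.surj_pow T n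
    refine ⟨P, fun z => ?_⟩
    have h2 := LinearMap.congr_fun hT z
    refine h2.symm.trans ?_
    rw [LinearMap.comp_apply, LinearMap.add_apply, map_add, add_eq_left, Submodule.mkQ_apply,
      Submodule.Quotient.mk_eq_zero, mem_span_pow_smul_top]
    exact ⟨T' z, rfl⟩
  choose P hP using h1
  have hP' : ∀ m n, m ≤ n → ∀ z, AdicCompletion.eval _ _ m (F (AdicCompletion.of _ _ z)) =
      Submodule.mkQ _ (L (P n) z) := by
    intro m n hmn z
    have h2 := hP n z
    rw [AdicCompletion.eval_apply] at h2 ⊢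
    rw [← (F (AdicCompletion.of _ _ z)).property hmn, h2]
    rfl
  refine ⟨Completion.mk h.comm P fun m n hmn => ?_, ?_⟩
  · have h1 : ∀ z, ∃ y, L (P n - P m) z = θ ^ m • y := by
      intro z
      have h2 := (hP' m n hmn z).symm.trans (hP m z)
      rw [Submodule.mkQ_apply, Submodule.mkQ_apply, Submodule.Quotient.eq,
        mem_span_pow_smul_top] at h2
      rw [map_sub]
      exact h2
    obtain ⟨T, hT⟩ := exists_eq_smul_of_range h.torsionFree m _ h1
    exact h.inj_pow _ m T hT
  · refine LinearMap.ext fun y => AdicCompletion.ext fun n => ?_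
    refine adicCompletion_end_eval_congr (h.toEnd _) F n (fun z => ?_) y
    rw [h.toEnd_of_apply_of _ n (P n) rfl, hP]

/-- The comparison isomorphism. -/
def equiv [Module.Projective Z N] (h : IsAdicEquiv L θ t) : Completion D t ≃+*
    Module.End (AdicCompletion (Ideal.span {θ}) Z) (AdicCompletion (Ideal.span {θ}) N) :=
  RingEquiv.ofBijective h.toEnd ⟨h.toEnd_injective, h.toEnd_surjective⟩

theorem equiv_of [Module.Projective Z N] (h : IsAdicEquiv L θ t) (P : D) :
    h.equiv (Completion.of t P) = AdicCompletion.map _ (L P) := h.toEnd_of P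

/-- No continuity has to be assumed: an element vanishing modulo `t ^ n` is `t ^ n s'`, and `e (t ^
n s') = L̂(t ^ n) e(s')` has values divisible by `θ ^ n`. So `e s` modulo `θ ^ n` depends only on a
representative of s. -/
theorem ringHom_ext (h : IsAdicEquiv L θ t) {e e' : Completion D t →+*
      Module.End (AdicCompletion (Ideal.span {θ}) Z) (AdicCompletion (Ideal.span {θ}) N)}
    (he : ∀ P, e (Completion.of t P) = AdicCompletion.map _ (L P))
    (he' : ∀ P, e' (Completion.of t P) = AdicCompletion.map _ (L P)) : e = e' := by
  have key : ∀ e : Completion D t →+*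
      Module.End (AdicCompletion (Ideal.span {θ}) Z) (AdicCompletion (Ideal.span {θ}) N),
      (∀ P, e (Completion.of t P) = AdicCompletion.map _ (L P)) →
      ∀ s y n, AdicCompletion.eval _ _ n (e s y) =
        AdicCompletion.eval _ _ n (AdicCompletion.map _ (L (Completion.rep s n)) y) := by
    intro e he s y n
    obtain ⟨s', hs'⟩ := Completion.exists_eq_pow_mul h.comm h.regular
      (s - Completion.of t (Completion.rep s n)) n (by
        change s.1 n - ((Completion.rep s n : D) : (TwoSidedIdeal.span {t ^ n}).ringCon.Quotient) = 0
        rw [Completion.coe_rep, sub_self])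
    have h1 : s = Completion.of t (Completion.rep s n) + Completion.of t t ^ n * s' := by
      rw [← hs']; abel
    have h2 : e s y = AdicCompletion.map _ (L (Completion.rep s n)) y +
        AdicCompletion.map _ (L (t ^ n)) (e s' y) := by
      conv_lhs => rw [h1]
      rw [map_add, map_mul, ← _root_.map_pow, he, he]
      rfl
    rw [h2, map_add, add_eq_left]
    obtain ⟨c, S, -, hL⟩ := h.map_pow n
    rw [AdicCompletion.eval_apply, AdicCompletion.map_val_apply, hL]
    obtain ⟨z, hz⟩ := Submodule.Quotient.mk_surjective _ ((e s' y).val n)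
    rw [← hz, LinearMap.reduceModIdeal_apply, Submodule.Quotient.mk_eq_zero,
      mem_span_pow_smul_top]
    exact ⟨(c • 1 + θ • S : Module.End Z N) z, rfl⟩
  refine RingHom.ext fun s => LinearMap.ext fun y => AdicCompletion.ext fun n => ?_
  exact (key e he s y n).trans (key e' he' s y n).symm

end IsAdicEquiv

end EndComparison

variable {R A : Type*} [CommRing R] [CommRing A] [Algebra R A] {σ : A →ₐ[R] A}

/-! ### Twisted derivations -/

theorem SigmaDerivation.map_one (δ : SigmaDerivation σ) : δ (1 : A) = 0 := by
  simpa using δ.leibniz 1 1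

theorem SigmaDerivation.map_algebraMap (δ : SigmaDerivation σ) (r : R) :
    δ (algebraMap R A r) = 0 := by
  rw [Algebra.algebraMap_eq_smul_one, map_smul, δ.map_one, smul_zero]

/-- In terms of a coordinate `x`, the endomorphism `σ` is determined by the `σ`-derivation. -/
theorem SigmaDerivation.sigma_eq (δ : SigmaDerivation σ) {q : R} {x : A} (hσ : σ x = q • x)
    (hδ : δ x = 1) (a : A) : σ a = a + q • (x * δ a) - x * δ a := by
  have h1 := δ.leibniz a x
  have h2 := δ.leibniz x a
  rw [mul_comm x a, h1, hδ, hσ, smul_mul_assoc] at h2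
  linear_combination h2

/-- Killing `x` and R-linearity make D vanish on the image of `R[X]`, so it is an `R[X]`-derivation;
it factors through the Kähler differentials of A over `R[X]`, which are zero. -/
theorem derivation_eq_zero_of_etale (f : R[X] →ₐ[R] A) (hf : f.toRingHom.Etale) (D : A →ₗ[R] A)
    (hD : ∀ a b, D (a * b) = D a * b + a * D b) (hx : D (f X) = 0) (a : A) : D a = 0 := by
  algebraize [f.toRingHom]
  have h1 : D 1 = 0 := by simpa using hD 1 1
  have h0 : ∀ g : R[X], D (f g) = 0 := by
    intro g
    induction g using Polynomial.induction_on with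
    | C r =>
      rw [← Polynomial.algebraMap_eq, AlgHom.commutes, Algebra.algebraMap_eq_smul_one, map_smul, h1,
        smul_zero]
    | add g h hg hh => rw [map_add, map_add, hg, hh, add_zero]
    | monomial n r h =>
      rw [pow_succ, ← mul_assoc, map_mul, hD, h, hx]; simp
  let D' : Derivation R[X] A A := Derivation.mk'
    { toFun := D
      map_add' := map_add D
      map_smul' := fun g a => by
        rw [Algebra.smul_def, hD]
        change D (f g) * a + _ = _
        rw [h0, zero_mul, zero_add]
        exact (Algebra.smul_def g (D a)).symm } fun a b => by
      change D (a * b) = a * D b + b * D a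
      rw [hD]; ring
  have h2 : D' = 0 := by
    rw [← D'.liftKaehlerDifferential_comp, Subsingleton.elim D'.liftKaehlerDifferential 0]
    rfl
  exact DFunLike.congr_fun h2 a

/-- Computing `E(bx) = E(xb)` in two ways gives `x E(b) = q x E(b)`. Since `σ(a) - a = (q - 1) x
δ(a)`, the twist disappears from the Leibniz rule and E is an ordinary derivation. -/
theorem twisted_eq_zero_of_etale (f : R[X] →ₐ[R] A) (hf : f.toRingHom.Etale)
    (δ : SigmaDerivation σ) {q : R} (hσ : σ (f X) = q • f X) (hδ : δ (f X) = 1) (E : A →ₗ[R] A)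
    (hE : ∀ a b, E (a * b) = E a * b + σ a * E b) (hx : E (f X) = 0) (a : A) : E a = 0 := by
  refine derivation_eq_zero_of_etale f hf E (fun a b => ?_) hx a
  have h1 := hE b (f X)
  have h2 := hE (f X) b
  rw [mul_comm (f X) b, h1, hx, hσ, smul_mul_assoc] at h2
  have h3 := δ.sigma_eq hσ hδ a
  rw [hE, h3]
  have h4 : (q • (f X * δ a)) * E b = δ a * (q • (f X * E b)) := by
    simp only [Algebra.smul_def]; ring
  rw [sub_mul, add_mul, h4]
  linear_combination (-δ a) * h2

/-- The defect `F = δσ - qσδ` satisfies `F(ab) = F(a)σ(b) + σ²(a)F(b)`. Composing with `σ ^ (p -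
1)`, the inverse of σ, gives a σ-derivation that kills `x`. -/
theorem delta_sigma_of_etale (f : R[X] →ₐ[R] A) (hf : f.toRingHom.Etale)
    (δ : SigmaDerivation σ) {q : R} (hσ : σ (f X) = q • f X) (hδ : δ (f X) = 1) {p : ℕ}
    (hp : p ≠ 0) (hσp : ∀ a, σ^[p] a = a) (a : A) : δ (σ a) = q • σ (δ a) := by
  obtain ⟨m, rfl⟩ := Nat.exists_eq_succ_of_ne_zero hp
  have h1 : ∀ a, (σ ^ m) (σ a) = a := by
    intro a
    rw [AlgHom.coe_pow, ← Function.iterate_succ_apply]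
    exact hσp a
  let F : A →ₗ[R] A := δ.toLinearMap ∘ₗ σ.toLinearMap - q • (σ.toLinearMap ∘ₗ δ.toLinearMap)
  have hF : ∀ a, F a = δ (σ a) - q • σ (δ a) := fun a => rfl
  have hE : ∀ a, ((σ ^ m).toLinearMap ∘ₗ F) a = 0 := by
    refine twisted_eq_zero_of_etale f hf δ hσ hδ _ (fun a b => ?_) ?_
    · have h2 : F (a * b) = F a * σ b + σ (σ a) * F b := by
        rw [hF, hF, hF, map_mul, δ.leibniz, δ.leibniz, map_add, map_mul, map_mul]
        simp only [Algebra.smul_def]; ring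
      change (σ ^ m) (F (a * b)) = (σ ^ m) (F a) * b + σ a * (σ ^ m) (F b)
      rw [h2, map_add, map_mul, map_mul, h1, h1]
    · change (σ ^ m) (F (f X)) = 0
      rw [hF, hσ, hδ, map_smul, hδ, _root_.map_one, sub_self, map_zero]
  have h3 : F a = 0 := by
    have h4 := congrArg σ (hE a)
    change σ ((σ ^ m) (F a)) = σ 0 at h4
    rw [map_zero] at h4
    rw [← h4, ← AlgHom.mul_apply, ← pow_succ', AlgHom.coe_pow]
    exact (hσp _).symm
  rw [hF] at h3
  exact sub_eq_zero.1 h3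

/-! ### Coefficients of twisted differential operators -/

namespace OreExt

section Coefficients

variable (δ : SigmaDerivation σ)

/-- The coefficient of `∂ ^ n`. -/
def cf (n : ℕ) : OreExt δ →+ A := Finsupp.applyAddHom n

variable {δ}

theorem cf_monomial (n m : ℕ) (a : A) : cf δ n (monomial δ m a) = if m = n then a else 0 :=
  Finsupp.single_apply

theorem cf_coeff (n : ℕ) (a : A) : cf δ n (coeff δ a) = if 0 = n then a else 0 :=
  cf_monomial n 0 a

theorem cf_smul (n : ℕ) (a : A) (P : OreExt δ) : cf δ n (a • P) = a * cf δ n P := rfl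

theorem ext_cf {P Q : OreExt δ} (h : ∀ n, cf δ n P = cf δ n Q) : P = Q := Finsupp.ext h

theorem exists_sum_monomial (P : OreExt δ) :
    ∃ s : Finset ℕ, P = ∑ n ∈ s, monomial δ n (cf δ n P) :=
  ⟨Finsupp.support P, (Finsupp.sum_single P).symm⟩

theorem del_mul (P : OreExt δ) : del δ * P = mulDel δ P := by
  rw [mul_def, del, mulL_monomial, one_smul, pow_one]

theorem cf_del_mul_zero (P : OreExt δ) : cf δ 0 (del δ * P) = δ (cf δ 0 P) := by
  rw [del_mul]
  have : (cf δ 0).comp (mulDel δ) = (δ.toLinearMap : A →+ A).comp (cf δ 0) := by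
    apply addHom_ext
    intro n b
    change cf δ 0 (mulDel δ (monomial δ n b)) = δ (cf δ 0 (monomial δ n b))
    rw [mulDel_monomial, map_add, cf_monomial, cf_monomial, cf_monomial, if_neg n.succ_ne_zero]
    split_ifs <;> simp
  exact DFunLike.congr_fun this P

theorem cf_del_mul_succ (n : ℕ) (P : OreExt δ) :
    cf δ (n + 1) (del δ * P) = σ (cf δ n P) + δ (cf δ (n + 1) P) := by
  rw [del_mul]
  have : (cf δ (n + 1)).comp (mulDel δ) =
      (σ : A →+ A).comp (cf δ n) + (δ.toLinearMap : A →+ A).comp (cf δ (n + 1)) := by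
    apply addHom_ext
    intro m b
    change cf δ (n + 1) (mulDel δ (monomial δ m b)) =
      σ (cf δ n (monomial δ m b)) + δ (cf δ (n + 1) (monomial δ m b))
    rw [mulDel_monomial, map_add]
    simp only [cf_monomial, add_left_inj]
    split_ifs <;> simp
  exact DFunLike.congr_fun this P

theorem monomial_mul_del_pow (n m : ℕ) (a : A) :
    monomial δ n a * del δ ^ m = monomial δ (n + m) a := by
  rw [monomial_eq, monomial_eq, mul_assoc, pow_add]

theorem cf_mul_del_pow (n m : ℕ) (P : OreExt δ) :
    cf δ n (P * del δ ^ m) = if m ≤ n then cf δ (n - m) P else 0 := by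
  have : (cf δ n).comp (AddMonoidHom.mulRight (del δ ^ m)) =
      if m ≤ n then cf δ (n - m) else 0 := by
    apply addHom_ext
    intro k b
    change cf δ n (monomial δ k b * del δ ^ m) = _
    rw [monomial_mul_del_pow, cf_monomial]
    split_ifs with h1 h2 h2
    · rw [cf_monomial, if_pos (by omega)]
    · omega
    · rw [cf_monomial, if_neg (by omega)]
    · rfl
  have h := DFunLike.congr_fun this P
  refine h.trans ?_
  split_ifs <;> rfl

theorem commute_of_commute {Q : OreExt δ} (h1 : ∀ a, Commute Q (coeff δ a))
    (h2 : Commute Q (del δ)) (P : OreExt δ) : Commute Q P := by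
  obtain ⟨s, hs⟩ := exists_sum_monomial P
  rw [hs]
  refine Commute.sum_right _ _ _ fun n _ => ?_
  rw [monomial_eq]
  exact (h1 _).mul_right (h2.pow_right n)

theorem iterate_sigma_delta {q : R} (hc : ∀ a, δ (σ a) = q • σ (δ a)) (k : ℕ) (a : A) :
    δ (σ^[k] a) = q ^ k • σ^[k] (δ a) := by
  induction k generalizing a with
  | zero => simp
  | succ k ih =>
    rw [Function.iterate_succ_apply, ih, hc, Function.iterate_succ_apply, ← AlgHom.coe_pow,
      map_smul, smul_smul, pow_succ]

/-- The q-Leibniz formula. Moving δ past `σ ^ (k + 1)` costs `q ^ (k + 1)`, which is the weight in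
the q-Pascal rule. -/
theorem cf_del_pow_mul_coeff {q : R} (hc : ∀ a, δ (σ a) = q • σ (δ a)) (n k : ℕ) (a : A) :
    cf δ k (del δ ^ n * coeff δ a) = aeval q (qPascal n k) • σ^[k] (δ^[n - k] a) := by
  induction n generalizing k with
  | zero =>
    rw [pow_zero, one_mul, cf_coeff]
    cases k with
    | zero => simp [qPascal_zero_right]
    | succ k => simp [qPascal_eq_zero]
  | succ n ih =>
    rw [pow_succ', mul_assoc]
    cases k with
    | zero =>
      rw [cf_del_mul_zero, ih, qPascal_zero_right, qPascal_zero_right, Nat.sub_zero, Nat.sub_zero,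
        Function.iterate_succ_apply']
      simp
    | succ k =>
      rw [cf_del_mul_succ, ih, ih, map_smul, map_smul, iterate_sigma_delta hc, qPascal_succ_succ,
        Nat.add_sub_add_right, map_add, add_smul, map_mul, ← Function.iterate_succ_apply' σ]
      congr 1
      rcases lt_or_ge k n with h | h
      · rw [show n - k = (n - (k + 1)) + 1 by omega, Function.iterate_succ_apply' δ, smul_smul]
        simp [mul_comm]
      · rw [qPascal_eq_zero (by omega)]; simp

theorem del_pow_prime_mul_coeff {p : ℕ} (hp : p.Prime) {q : R} (hq : aeval q (qInt p) = 0)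
    (hc : ∀ a, δ (σ a) = q • σ (δ a)) (hσp : ∀ a, σ^[p] a = a) (a : A) :
    del δ ^ p * coeff δ a = coeff δ a * del δ ^ p + coeff δ (δ^[p] a) := by
  refine ext_cf fun k => ?_
  rw [cf_del_pow_mul_coeff hc, map_add, cf_mul_del_pow, cf_coeff, cf_coeff]
  rcases Nat.eq_zero_or_pos k with rfl | h0
  · rw [if_neg (by have := hp.pos; omega), qPascal_zero_right]; simp
  · rcases lt_trichotomy k p with h | rfl | h
    · rw [aeval_qPascal_prime hp hq h0 h, if_neg (by omega), if_neg (by omega)]; simp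
    · rw [qPascal_self, if_pos le_rfl, if_pos (by omega), if_neg (by omega)]; simp [hσp]
    · rw [qPascal_eq_zero h, if_pos h.le, if_neg (by omega), if_neg (by omega)]; simp

end Coefficients

end OreExt

/-- The consequences of étaleness that are used: `x` is a coordinate of `A`, with respect to which
`σ` is of order `p`. -/
structure IsCoordinate (δ : SigmaDerivation σ) (p : ℕ) (q : R) (x : A) : Prop where
  prime : p.Prime
  root : aeval q (qInt p) = 0
  sigma_x : σ x = q • x
  delta_x : δ x = 1
  iterate_delta : ∀ a, δ^[p] a = 0
  comm : ∀ P, OreExt.del δ ^ p * P = P * OreExt.del δ ^ p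

/-- By `del_pow_prime_mul_coeff`, expanding `∂ ^ p (ab)` in two ways and taking constant terms shows
that `δ ^ p` is a derivation. It kills `x` because `δ(δ x) = δ 1 = 0` and p ≥ 2. Hence it is zero,
and `∂ ^ p` commutes with A and with ∂. -/
theorem isCoordinate_of_etale {p : ℕ} (hp : p.Prime) {q : R} (hq : aeval q (qInt p) = 0)
    (f : R[X] →ₐ[R] A) (hf : f.toRingHom.Etale) (hσ : σ (f X) = q • f X)
    (hσp : ∀ a, σ^[p] a = a) (δ : SigmaDerivation σ) (hδ : δ (f X) = 1) :
    IsCoordinate δ p q (f X) := by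
  have hc := delta_sigma_of_etale f hf δ hσ hδ hp.ne_zero hσp
  have hD := OreExt.del_pow_prime_mul_coeff hp hq hc hσp
  have hpow : ∀ a, (δ.toLinearMap ^ p) a = δ^[p] a := fun a => by rw [Module.End.coe_pow]
  have h0 : ∀ a, δ^[p] a = 0 := by
    intro a
    rw [← hpow]
    refine derivation_eq_zero_of_etale f hf (δ.toLinearMap ^ p) (fun a b => ?_) ?_ a
    · have h1 := hD (a * b)
      rw [map_mul, ← mul_assoc, hD, add_mul, mul_assoc, hD] at h1
      have h2 := congrArg (OreExt.cf δ 0) h1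
      rw [mul_add, ← map_mul, ← map_mul, ← mul_assoc, ← map_mul] at h2
      simp only [map_add, OreExt.cf_mul_del_pow, OreExt.cf_coeff, if_neg hp.pos.not_ge,
        if_true, zero_add] at h2
      rw [hpow, hpow, hpow, ← h2, add_comm]
    · obtain ⟨m, rfl⟩ := Nat.exists_eq_add_of_le hp.two_le
      rw [hpow, add_comm, Function.iterate_add_apply]
      change δ^[m] (δ (δ (f X))) = 0
      rw [hδ, δ.map_one]
      exact iterate_map_zero δ.toLinearMap m
  refine ⟨hp, hq, hσ, hδ, h0, OreExt.commute_of_commute (fun a => ?_) ?_⟩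
  · have h1 := hD a
    rw [h0, map_zero, add_zero] at h1
    exact h1
  · exact (Commute.refl _).pow_left p

/-! ### The q-Taylor expansion of `A` over its constants -/

namespace IsCoordinate

variable {δ : SigmaDerivation σ} {p : ℕ} {q : R} {x : A}

theorem sigma_pow (h : IsCoordinate δ p q x) (n : ℕ) : σ (x ^ n) = q ^ n • x ^ n := by
  rw [map_pow, h.sigma_x, _root_.smul_pow]

theorem sigma_eq_self (h : IsCoordinate δ p q x) {c : A} (hc : δ c = 0) : σ c = c := by
  rw [δ.sigma_eq h.sigma_x h.delta_x, hc]; simp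

theorem delta_pow (h : IsCoordinate δ p q x) (n : ℕ) :
    δ (x ^ n) = aeval q (qInt n) • x ^ (n - 1) := by
  induction n with
  | zero => rw [pow_zero, δ.map_one, qInt_zero]; simp
  | succ n ih =>
    rw [pow_succ, δ.leibniz, ih, h.sigma_pow, h.delta_x, qInt_succ, map_add, add_smul]
    cases n with
    | zero => simp [qInt_zero]
    | succ n =>
      simp only [Nat.add_sub_cancel, smul_mul_assoc, mul_one, ← pow_succ, map_pow, aeval_X]

theorem delta_pow_mul (h : IsCoordinate δ p q x) (n : ℕ) {c : A} (hc : δ c = 0) :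
    δ (x ^ n * c) = aeval q (qInt n) • (x ^ (n - 1) * c) := by
  rw [δ.leibniz, hc, mul_zero, add_zero, h.delta_pow, smul_mul_assoc]

theorem iterate_delta_pow_mul (h : IsCoordinate δ p q x) (n : ℕ) {c : A} (hc : δ c = 0) :
    δ^[n] (x ^ n * c) = aeval q (qFactorial n) • c := by
  induction n with
  | zero => simp [qFactorial_zero]
  | succ n ih =>
    rw [Function.iterate_succ_apply, h.delta_pow_mul _ hc, Nat.add_sub_cancel,
      ← Module.End.coe_pow, map_smul, Module.End.coe_pow, ih, smul_smul, qFactorial_succ, map_mul,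
      mul_comm]

theorem iterate_delta_of_lt (h : IsCoordinate δ p q x) {n m : ℕ} (hnm : n < m) {c : A}
    (hc : δ c = 0) : δ^[m] (x ^ n * c) = 0 := by
  obtain ⟨k, rfl⟩ := Nat.exists_eq_add_of_lt hnm
  rw [show n + k + 1 = (k + 1) + n by ring, Function.iterate_add_apply,
    h.iterate_delta_pow_mul n hc, Function.iterate_succ_apply, map_smul, hc, smul_zero]
  exact iterate_map_zero δ.toLinearMap k

/-- The q-Taylor expansion: `A` is spanned by `1, x, …, x ^ (p - 1)` over the constants. -/
theorem exists_expansion (h : IsCoordinate δ p q x) (a : A) :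
    ∃ c : ℕ → A, (∀ k, δ (c k) = 0) ∧ a = ∑ k ∈ Finset.range p, x ^ k * c k := by
  have key : ∀ m ≤ p, ∀ a, δ^[m] a = 0 →
      ∃ c : ℕ → A, (∀ k, δ (c k) = 0) ∧ a = ∑ k ∈ Finset.range m, x ^ k * c k := by
    intro m
    induction m with
    | zero => exact fun _ a ha => ⟨0, fun k => map_zero _, by simpa using ha⟩
    | succ m ih =>
      intro hm a ha
      obtain ⟨u, hu⟩ := isUnit_aeval_qFactorial h.prime h.root (show m < p by omega)
      rw [Function.iterate_succ_apply'] at ha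
      -- The coefficient of `x ^ m` must be `δ ^ m(a) / (m)_q!`. It is a constant because `δ ^ (m +
      -- 1)` kills a, and subtracting its term leaves an element killed by `δ ^ m`.
      have hb : δ ((↑u⁻¹ : R) • δ^[m] a) = 0 := by rw [map_smul, ha, smul_zero]
      obtain ⟨c, hc, hac⟩ := ih (by omega) (a - x ^ m * ((↑u⁻¹ : R) • δ^[m] a)) (by
        rw [← Module.End.coe_pow, map_sub, Module.End.coe_pow, h.iterate_delta_pow_mul m hb, ← hu,
          smul_smul, Units.mul_inv, one_smul, sub_self])
      refine ⟨Function.update c m ((↑u⁻¹ : R) • δ^[m] a), fun k => ?_, ?_⟩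
      · rcases eq_or_ne k m with rfl | hk
        · rw [Function.update_self, hb]
        · rw [Function.update_of_ne hk, hc]
      · rw [Finset.sum_range_succ, Function.update_self, Finset.sum_congr rfl (g := fun k =>
          x ^ k * c k) fun k hk => by rw [Function.update_of_ne (Finset.mem_range.1 hk).ne], ← hac]
        ring
  exact key p le_rfl a (h.iterate_delta a)

/-- Applying `δ ^ m` to a sum with top exponent m isolates `(m)_q! c m`, and `(m)_q!` is a unit. -/
theorem expansion_unique (h : IsCoordinate δ p q x) {c : ℕ → A} (hc : ∀ k, δ (c k) = 0)
    (h0 : ∑ k ∈ Finset.range p, x ^ k * c k = 0) : ∀ k < p, c k = 0 := by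
  have key : ∀ m ≤ p, ∑ k ∈ Finset.range m, x ^ k * c k = 0 → ∀ k < m, c k = 0 := by
    intro m
    induction m with
    | zero => intro _ _ k hk; omega
    | succ m ih =>
      intro hm hs
      have h1 := congrArg (δ.toLinearMap ^ m) hs
      rw [map_sum, map_zero, Finset.sum_range_succ, Finset.sum_eq_zero fun k hk => by
        rw [Module.End.coe_pow, h.iterate_delta_of_lt (Finset.mem_range.1 hk) (hc k)], zero_add,
        Module.End.coe_pow, h.iterate_delta_pow_mul m (hc m)] at h1
      have h2 : c m = 0 := (isUnit_aeval_qFactorial h.prime h.root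
        (show m < p by omega)).smul_eq_zero.1 h1
      rw [Finset.sum_range_succ, h2, mul_zero, add_zero] at hs
      intro k hk
      rcases Nat.lt_succ_iff_lt_or_eq.1 hk with hk | rfl
      · exact ih (by omega) hs k hk
      · exact h2
  exact key p le_rfl h0

end IsCoordinate

/-! ### Finite expansions and the universal property of the Ore extension -/

namespace OreExt

variable {δ : SigmaDerivation σ}

theorem exists_bound (P : OreExt δ) : ∃ M, ∀ n, M ≤ n → cf δ n P = 0 := by
  refine ⟨(Finsupp.support P).sup id + 1, fun n hn => ?_⟩
  by_contra h
  have : n ≤ (Finsupp.support P).sup id :=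
    Finset.le_sup (f := id) (Finsupp.mem_support_iff.2 h)
  omega

theorem eq_sum_monomial {P : OreExt δ} {M : ℕ} (hM : ∀ n, M ≤ n → cf δ n P = 0) :
    P = ∑ n ∈ Finset.range M, monomial δ n (cf δ n P) := by
  refine ext_cf fun n => ?_
  simp only [map_sum, cf_monomial]
  rw [Finset.sum_ite_eq' (Finset.range M) n fun m => cf δ m P]
  split_ifs with h
  · rfl
  · exact hM n (by simpa using h)

/-- A ring homomorphism out of `D_{A,σ}`, given by its values on `A` and `∂`. -/
def liftRingHom {E : Type*} [Ring E] (ι : A →+* E) (d : E)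
    (hd : ∀ a, d * ι a = ι (σ a) * d + ι (δ a)) : OreExt δ →+* E :=
  let L : OreExt δ →+ E :=
    liftAdd δ fun n => (AddMonoidHom.mulRight (d ^ n)).comp (ι : A →+ E)
  have hL : ∀ n a, L (monomial δ n a) = ι a * d ^ n := fun n a => liftAdd_monomial δ _ n a
  have hsmul : ∀ (a : A) Q, L (a • Q) = ι a * L Q := fun a Q => by
    have : L.comp (DistribSMul.toAddMonoidHom (OreExt δ) a) =
        (AddMonoidHom.mulLeft (ι a)).comp L := by
      apply addHom_ext
      intro n b
      change L (a • monomial δ n b) = ι a * L (monomial δ n b)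
      rw [smul_monomial, hL, hL, map_mul, mul_assoc]
    exact DFunLike.congr_fun this Q
  have hdel : ∀ Q, L (mulDel δ Q) = d * L Q := fun Q => by
    have : L.comp (mulDel δ) = (AddMonoidHom.mulLeft d).comp L := by
      apply addHom_ext
      intro n b
      change L (mulDel δ (monomial δ n b)) = d * L (monomial δ n b)
      rw [mulDel_monomial, map_add, hL, hL, hL, ← mul_assoc, hd, add_mul, mul_assoc, pow_succ']
    exact DFunLike.congr_fun this Q
  have hdelpow : ∀ n Q, L ((mulDel δ ^ n) Q) = d ^ n * L Q := fun n => by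
    induction n with
    | zero => intro Q; rw [pow_zero, pow_zero, one_mul]; rfl
    | succ n ih =>
      intro Q
      rw [pow_succ, pow_succ, mul_assoc, ← hdel, ← ih]
      rfl
  { L with
    map_one' := by
      change L (monomial δ 0 1) = 1
      rw [hL, map_one, pow_zero, one_mul]
    map_mul' := fun P Q => by
      have : L.comp ((AddMonoidHom.mulRight Q)) = (AddMonoidHom.mulRight (L Q)).comp L := by
        apply addHom_ext
        intro n b
        change L (mulL δ (monomial δ n b) Q) = L (monomial δ n b) * L Q
        rw [mulL_monomial, hsmul, hdelpow, hL, mul_assoc]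
      exact DFunLike.congr_fun this P }

theorem liftRingHom_monomial {E : Type*} [Ring E] (ι : A →+* E) (d : E)
    (hd : ∀ a, d * ι a = ι (σ a) * d + ι (δ a)) (n : ℕ) (a : A) :
    liftRingHom ι d hd (monomial δ n a) = ι a * d ^ n := liftAdd_monomial δ _ n a

theorem inclZ_coe (z : ZD δ) : (inclZ δ z : OreExt δ) = z := rfl

theorem coeffZA_coe (a : A) : (coeffZA δ a : OreExt δ) = coeff δ a := rfl

theorem zd_smul_coe (z : ZD δ) (w : ZA δ) : ((z • w : ZA δ) : OreExt δ) = z * w := rfl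

theorem theta_coe {p : ℕ} (hθ : del δ ^ p ∈ Subring.center (OreExt δ)) :
    (theta hθ : OreExt δ) = del δ ^ p := rfl

end OreExt

/-! ### The centralizer and the centre as polynomial rings in `∂ ^ p` -/

namespace IsCoordinate

open OreExt

variable {δ : SigmaDerivation σ} {p : ℕ} {q : R} {x : A}

theorem del_pow_mem_center (h : IsCoordinate δ p q x) :
    del δ ^ p ∈ Subring.center (OreExt δ) :=
  Subring.mem_center_iff.2 fun P => (h.comm P).symm

theorem del_pow_succ_mul_x (h : IsCoordinate δ p q x) (m : ℕ) :
    del δ ^ (m + 1) * coeff δ x =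
      monomial δ (m + 1) (q ^ (m + 1) • x) +
        monomial δ m (algebraMap R A (aeval q (qInt (m + 1)))) := by
  induction m with
  | zero =>
    rw [zero_add, pow_one, del_mul]
    change mulDel δ (monomial δ 0 x) = _
    rw [mulDel_monomial, h.sigma_x, h.delta_x, qInt_one]; simp
  | succ m ih =>
    rw [pow_succ', mul_assoc, ih, mul_add, del_mul, del_mul, mulDel_monomial, mulDel_monomial,
      map_smul σ, map_smul δ.toLinearMap, h.sigma_x, h.delta_x, AlgHom.commutes, δ.map_algebraMap, map_zero,
      add_zero, smul_smul, ← pow_succ, add_assoc, ← map_add (OreExt.monomial δ (m + 1)),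
      qInt_succ (m + 1), map_add (aeval q), map_add (algebraMap R A), map_pow (aeval q), aeval_X,
      Algebra.algebraMap_eq_smul_one (q ^ (m + 1)), add_comm (q ^ (m + 1) • (1 : A))]

theorem cf_mul_x (h : IsCoordinate δ p q x) (n : ℕ) (P : OreExt δ) :
    cf δ n (P * coeff δ x) = q ^ n • (x * cf δ n P) + aeval q (qInt (n + 1)) • cf δ (n + 1) P := by
  obtain ⟨M, hM⟩ := exists_bound P
  have key : ∀ m a, cf δ n (monomial δ m a * coeff δ x) =
      q ^ n • (x * cf δ n (monomial δ m a)) +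
        aeval q (qInt (n + 1)) • cf δ (n + 1) (monomial δ m a) := by
    intro m a
    rw [monomial_eq, mul_assoc, ← smul_eq_coeff_mul, ← monomial_eq, cf_smul]
    cases m with
    | zero =>
      rw [pow_zero, one_mul, cf_coeff, cf_monomial, cf_monomial, if_neg (Nat.succ_ne_zero n).symm]
      split_ifs with h0
      · subst h0; simp [mul_comm]
      · simp
    | succ m =>
      rw [h.del_pow_succ_mul_x, map_add, cf_monomial, cf_monomial, cf_monomial, cf_monomial]
      simp only [Nat.add_right_cancel_iff]
      rcases eq_or_ne (m + 1) n with rfl | h1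
      · simp only [if_true, if_neg (show ¬ m = m + 1 by omega), add_zero,
          Algebra.smul_def]
        ring
      · rcases eq_or_ne m n with rfl | h2
        · simp [Algebra.smul_def, mul_comm]
        · simp [h1, h2]
  rw [eq_sum_monomial hM, Finset.sum_mul]
  simp only [map_sum, key, Finset.mul_sum, Finset.smul_sum, Finset.sum_add_distrib]

/-- Commuting with `x` already suffices. It reads `q ^ n x c_n + (n+1)_q c_{n+1} = x c_n`. The two
terms in `c_n` cancel, either because p divides n and `q ^ n = 1` or because `c_n = 0` by induction.
If p does not divide n + 1, then `(n+1)_q` is a unit and `c_{n+1} = 0`. -/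
theorem cf_eq_zero_of_mem_ZA (h : IsCoordinate δ p q x) {P : OreExt δ} (hP : P ∈ ZA δ) :
    ∀ n, ¬ p ∣ n → cf δ n P = 0 := by
  have hx : ∀ n, q ^ n • (x * cf δ n P) + aeval q (qInt (n + 1)) • cf δ (n + 1) P =
      x * cf δ n P := by
    intro n
    rw [← h.cf_mul_x, ← cf_smul, smul_eq_coeff_mul,
      (Subring.mem_centralizer_iff.1 hP) _ ⟨x, rfl⟩]
  intro n
  induction n with
  | zero => intro h0; exact absurd (dvd_zero p) h0
  | succ n ih =>
    intro hn
    have h1 := hx n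
    have h2 : q ^ n • (x * cf δ n P) = x * cf δ n P := by
      by_cases hpn : p ∣ n
      · obtain ⟨k, rfl⟩ := hpn
        rw [pow_mul, pow_eq_one_of_aeval_qInt h.root, one_pow, one_smul]
      · rw [ih hpn]; simp
    rw [h2, add_eq_left] at h1
    exact (isUnit_aeval_qInt h.prime h.root hn).smul_eq_zero.1 h1

end IsCoordinate

namespace OreExt

variable {δ : SigmaDerivation σ} {p : ℕ} (hθ : del δ ^ p ∈ Subring.center (OreExt δ))

theorem theta_pow_smul_coeffZA_coe (k : ℕ) (a : A) :
    ((theta hθ ^ k • coeffZA δ a : ZA δ) : OreExt δ) = monomial δ (p * k) a := by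
  rw [zd_smul_coe, coeffZA_coe, SubmonoidClass.coe_pow, theta_coe, monomial_eq, ← pow_mul]
  have : del δ ^ (p * k) ∈ Subring.center (OreExt δ) := by
    rw [pow_mul]; exact pow_mem hθ k
  exact (Subring.mem_center_iff.1 this _).symm

theorem theta_pow_smul_coe (k : ℕ) (w : ZA δ) :
    ((theta hθ ^ k • w : ZA δ) : OreExt δ) = w * del δ ^ (p * k) := by
  rw [zd_smul_coe, SubmonoidClass.coe_pow, theta_coe, ← pow_mul]
  have : del δ ^ (p * k) ∈ Subring.center (OreExt δ) := by
    rw [pow_mul]; exact pow_mem hθ k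
  exact (Subring.mem_center_iff.1 this _).symm

theorem coeffZA_mul_smul (a : A) (z : ZD δ) (w : ZA δ) :
    coeffZA δ a * z • w = z • (coeffZA δ a * w) := (mulZA δ a).map_smul z w

end OreExt

namespace IsCoordinate

open OreExt

variable {δ : SigmaDerivation σ} {p : ℕ} {q : R} {x : A}
  (hθ : del δ ^ p ∈ Subring.center (OreExt δ))

/-- `ZA_{A,σ}` is the polynomial ring in `∂ ^ p` over `A`. -/
theorem exists_sum_theta (h : IsCoordinate δ p q x) (w : ZA δ) :
    ∃ M, w = ∑ k ∈ Finset.range M, theta hθ ^ k • coeffZA δ (cf δ (p * k) w) := by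
  obtain ⟨M, hM⟩ := exists_bound (w : OreExt δ)
  refine ⟨M, Subtype.ext (ext_cf fun n => ?_)⟩
  rw [AddSubmonoidClass.coe_finsetSum]
  simp only [theta_pow_smul_coeffZA_coe, map_sum, cf_monomial]
  by_cases hn : p ∣ n
  · obtain ⟨k, rfl⟩ := hn
    simp only [Nat.mul_right_inj h.prime.ne_zero]
    rw [Finset.sum_ite_eq' (Finset.range M) k fun m => cf δ (p * m) (w : OreExt δ)]
    split_ifs with hk
    · rfl
    · refine hM _ (le_trans ?_ (Nat.le_mul_of_pos_left k h.prime.pos))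
      simpa using hk
  · rw [h.cf_eq_zero_of_mem_ZA w.2 n hn, Finset.sum_eq_zero]
    rintro k -
    rw [if_neg]
    rintro rfl
    exact hn (dvd_mul_right p k)

theorem addHom_ext_ZA (h : IsCoordinate δ p q x) {M : Type*} [AddCommMonoid M] {F G : ZA δ →+ M}
    (H : ∀ k a, F (theta hθ ^ k • coeffZA δ a) = G (theta hθ ^ k • coeffZA δ a)) : F = G := by
  ext w
  obtain ⟨M, hM⟩ := h.exists_sum_theta hθ w
  rw [hM, map_sum, map_sum]
  exact Finset.sum_congr rfl fun k _ => H k _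

theorem linearMap_ext_ZA (h : IsCoordinate δ p q x) {M : Type*} [AddCommMonoid M]
    [Module (ZD δ) M] {F G : ZA δ →ₗ[ZD δ] M} (H : ∀ a, F (coeffZA δ a) = G (coeffZA δ a)) :
    F = G := by
  have hFG : F.toAddMonoidHom = G.toAddMonoidHom := by
    refine h.addHom_ext_ZA h.del_pow_mem_center fun k a => ?_
    change F _ = G _
    rw [map_smul, map_smul, H]
  exact LinearMap.ext fun w => DFunLike.congr_fun hFG w

/-- A constant of `A`, as an element of the centre. -/
def constZ (h : IsCoordinate δ p q x) {c : A} (hc : δ c = 0) : ZD δ :=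
  ⟨coeff δ c, Subring.mem_center_iff.2 fun P => by
    refine (commute_of_commute (fun a => ?_) ?_ P).symm
    · change _ * _ = _ * _
      rw [← map_mul, ← map_mul, mul_comm]
    · change _ * _ = _ * _
      rw [del_mul_coeff, hc, h.sigma_eq_self hc, map_zero, add_zero]⟩

theorem constZ_smul_coeffZA (h : IsCoordinate δ p q x) {c : A} (hc : δ c = 0) (a : A) :
    h.constZ hc • coeffZA δ a = coeffZA δ (c * a) := Subtype.ext (map_mul (coeff δ) c a).symm

/-- Comparing coefficients in `∂z = z∂` gives `σ(c_{n-1}) + δ(c_n) = c_{n-1}`. When p divides a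
positive n, the neighbour `c_{n-1}` vanishes; when p does not divide n, `c_n` itself does. -/
theorem delta_cf (h : IsCoordinate δ p q x) (z : ZD δ) (n : ℕ) :
    δ (cf δ n (z : OreExt δ)) = 0 := by
  have h1 := Subring.mem_center_iff.1 z.2 (del δ)
  have h2 := congrArg (cf δ n) h1
  have h3 := cf_mul_del_pow n 1 (z : OreExt δ)
  rw [pow_one] at h3
  rw [h3] at h2
  have h0 := h.cf_eq_zero_of_mem_ZA (inclZ δ z).2
  rw [inclZ_coe] at h0
  cases n with
  | zero => rwa [cf_del_mul_zero, if_neg (by omega)] at h2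
  | succ n =>
    by_cases hn : p ∣ n + 1
    · have hn' : ¬ p ∣ n := fun h' =>
        h.prime.one_lt.ne' (Nat.dvd_one.1 ((Nat.dvd_add_right h').1 hn))
      rwa [cf_del_mul_succ, if_pos (by omega), Nat.add_sub_cancel, h0 n hn', map_zero,
        zero_add] at h2
    · rw [h0 _ hn, map_zero]

theorem zd_eq_sum (h : IsCoordinate δ p q x) (z : ZD δ) :
    ∃ M, z = ∑ k ∈ Finset.range M, theta hθ ^ k * h.constZ (h.delta_cf z (p * k)) := by
  obtain ⟨M, hM⟩ := h.exists_sum_theta hθ (inclZ δ z)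
  refine ⟨M, Subtype.ext ?_⟩
  have h1 := congrArg Subtype.val hM
  rw [AddSubmonoidClass.coe_finsetSum] at h1 ⊢
  exact h1

/-- Additive maps that commute with `∂ ^ p` and with constants are linear over the centre. -/
def mkLinear (h : IsCoordinate δ p q x) {M : Type*} [AddCommGroup M] [Module (ZD δ) M]
    (F : ZA δ →+ M) (h1 : ∀ w, F (theta hθ • w) = theta hθ • F w)
    (h2 : ∀ (c : A) (hc : δ c = 0) w, F (h.constZ hc • w) = h.constZ hc • F w) :
    ZA δ →ₗ[ZD δ] M where
  __ := F
  map_smul' z w := by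
    have h3 : ∀ k w, F (theta hθ ^ k • w) = theta hθ ^ k • F w := by
      intro k
      induction k with
      | zero => intro w; simp
      | succ k ih => intro w; rw [pow_succ, mul_smul, ih, h1, mul_smul]
    obtain ⟨M, hM⟩ := h.zd_eq_sum hθ z
    change F (z • w) = z • F w
    rw [hM, Finset.sum_smul, Finset.sum_smul, map_sum]
    refine Finset.sum_congr rfl fun k _ => ?_
    rw [mul_smul, h3, h2, mul_smul]

/-! ### `ZA_{A,σ}` is free over the centre -/

theorem linearIndependent_pow (h : IsCoordinate δ p q x) :
    LinearIndependent (ZD δ) fun i : Fin p => coeffZA δ (x ^ (i : ℕ)) := by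
  rw [Fintype.linearIndependent_iff]
  intro g hg i
  refine Subtype.ext (ext_cf fun n => ?_)
  have h1 := congrArg (fun w : ZA δ => cf δ n (w : OreExt δ)) hg
  simp only [AddSubmonoidClass.coe_finsetSum, map_sum] at h1
  have h2 : ∀ i : Fin p, cf δ n ((g i • coeffZA δ (x ^ (i : ℕ)) : ZA δ) : OreExt δ) =
      x ^ (i : ℕ) * cf δ n (g i : OreExt δ) := by
    intro i
    rw [zd_smul_coe, coeffZA_coe, ← cf_smul, smul_eq_coeff_mul,
      Subring.mem_center_iff.1 (g i).2]
  simp only [h2] at h1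
  let c : ℕ → A := fun k => if hk : k < p then cf δ n (g ⟨k, hk⟩ : OreExt δ) else 0
  have h3 : ∑ k ∈ Finset.range p, x ^ k * c k = 0 := by
    rw [← Fin.sum_univ_eq_sum_range (fun k => x ^ k * c k)]
    refine Eq.trans (Finset.sum_congr rfl fun i _ => ?_) h1
    simp only [c, dif_pos i.2]
  have h4 := h.expansion_unique (fun k => by
    by_cases hk : k < p
    · simp only [c, dif_pos hk]; exact h.delta_cf _ _
    · simp only [c, dif_neg hk]; exact map_zero _) h3 i i.2
  simp only [c, dif_pos i.2] at h4
  exact h4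

theorem span_pow (h : IsCoordinate δ p q x) :
    ⊤ ≤ Submodule.span (ZD δ) (Set.range fun i : Fin p => coeffZA δ (x ^ (i : ℕ))) := by
  rintro w -
  obtain ⟨M, hM⟩ := h.exists_sum_theta h.del_pow_mem_center w
  rw [hM]
  refine Submodule.sum_mem _ fun k _ => Submodule.smul_mem _ _ ?_
  obtain ⟨c, hc, hac⟩ := h.exists_expansion (cf δ (p * k) w)
  rw [hac, map_sum]
  refine Submodule.sum_mem _ fun i hi => ?_
  rw [mul_comm, ← h.constZ_smul_coeffZA (hc i)]
  exact Submodule.smul_mem _ _ (Submodule.subset_span ⟨⟨i, Finset.mem_range.1 hi⟩, rfl⟩)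

/-- Needed for surjectivity, to lift endomorphisms modulo `θ ^ n`. -/
theorem projective_ZA (h : IsCoordinate δ p q x) : Module.Projective (ZD δ) (ZA δ) :=
  haveI := Module.Free.of_basis (Module.Basis.mk h.linearIndependent_pow h.span_pow)
  inferInstance

/-! ### The action of `D_{A,σ}` on `ZA_{A,σ}` -/

/-- The operator `x ^ (p - 1) ∂ ^ p σ + ∂` on `D_{A,σ}`, acting on coefficients. -/
def twistDelD (δ : SigmaDerivation σ) (p : ℕ) (x : A) : OreExt δ →+ OreExt δ :=
  liftAdd δ fun n => (monomial δ n).comp (δ.toLinearMap : A →+ A) +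
    (monomial δ (n + p)).comp ((AddMonoidHom.mulLeft (x ^ (p - 1))).comp (σ : A →+ A))

theorem twistDelD_monomial (n : ℕ) (a : A) : twistDelD δ p x (monomial δ n a) =
    monomial δ n (δ a) + monomial δ (n + p) (x ^ (p - 1) * σ a) := by
  unfold twistDelD
  exact liftAdd_monomial δ _ n a

theorem twistDelD_theta_pow (k : ℕ) (a : A) :
    twistDelD δ p x (theta hθ ^ k • coeffZA δ a : ZA δ) =
      (theta hθ ^ k • coeffZA δ (δ a) +
        theta hθ ^ (k + 1) • coeffZA δ (x ^ (p - 1) * σ a) : ZA δ) := by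
  rw [Subring.coe_add, theta_pow_smul_coeffZA_coe, theta_pow_smul_coeffZA_coe,
    theta_pow_smul_coeffZA_coe, twistDelD_monomial, mul_add, mul_one]

theorem twistDelD_mem (h : IsCoordinate δ p q x) (w : ZA δ) :
    twistDelD δ p x w ∈ ZA δ := by
  obtain ⟨M, hM⟩ := h.exists_sum_theta h.del_pow_mem_center w
  rw [hM, AddSubmonoidClass.coe_finsetSum, map_sum]
  refine sum_mem fun k _ => ?_
  rw [twistDelD_theta_pow]
  exact Subtype.prop _

/-- The restriction of `twistDelD` to `ZA_{A,σ}`. -/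
def twistDelAdd (h : IsCoordinate δ p q x) : ZA δ →+ ZA δ :=
  ((twistDelD δ p x).comp (ZA δ).subtype.toAddMonoidHom).codRestrict (ZA δ) h.twistDelD_mem

theorem twistDelAdd_theta_pow (h : IsCoordinate δ p q x) (k : ℕ) (a : A) :
    h.twistDelAdd (theta hθ ^ k • coeffZA δ a) = theta hθ ^ k • coeffZA δ (δ a) +
        theta hθ ^ (k + 1) • coeffZA δ (x ^ (p - 1) * σ a) :=
  Subtype.ext (twistDelD_theta_pow hθ k a)

/-- The action of `∂` on `ZA_{A,σ}`. -/
def twistDel (h : IsCoordinate δ p q x) : Module.End (ZD δ) (ZA δ) :=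
  h.mkLinear hθ h.twistDelAdd
    (fun w => by
      have : h.twistDelAdd.comp (DistribSMul.toAddMonoidHom (ZA δ) (theta hθ)) =
          (DistribSMul.toAddMonoidHom (ZA δ) (theta hθ)).comp h.twistDelAdd := by
        refine h.addHom_ext_ZA hθ fun k a => ?_
        change h.twistDelAdd (theta hθ • theta hθ ^ k • coeffZA δ a) =
          theta hθ • h.twistDelAdd (theta hθ ^ k • coeffZA δ a)
        rw [smul_smul, ← pow_succ', twistDelAdd_theta_pow, twistDelAdd_theta_pow, smul_add,
          smul_smul, smul_smul, ← pow_succ', ← pow_succ']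
      exact DFunLike.congr_fun this w)
    (fun c hc w => by
      have : h.twistDelAdd.comp (DistribSMul.toAddMonoidHom (ZA δ) (h.constZ hc)) =
          (DistribSMul.toAddMonoidHom (ZA δ) (h.constZ hc)).comp h.twistDelAdd := by
        refine h.addHom_ext_ZA hθ fun k a => ?_
        change h.twistDelAdd (h.constZ hc • theta hθ ^ k • coeffZA δ a) =
          h.constZ hc • h.twistDelAdd (theta hθ ^ k • coeffZA δ a)
        rw [smul_comm, constZ_smul_coeffZA, twistDelAdd_theta_pow, twistDelAdd_theta_pow, smul_add,
          smul_comm _ (theta hθ ^ k), smul_comm _ (theta hθ ^ (k + 1)), constZ_smul_coeffZA,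
          constZ_smul_coeffZA, δ.leibniz, hc, map_mul σ, h.sigma_eq_self hc, zero_mul, zero_add,
          mul_left_comm]
      exact DFunLike.congr_fun this w)

/-- The formula is forced by the goal that ∂ act on A by `z ↦ Φ(∂z)`: here `∂z = σ(z)∂ + δ(z)` and
`Φ(∂) = x ^ (p - 1) θ`. -/
theorem twistDel_coeffZA (h : IsCoordinate δ p q x) (a : A) :
    h.twistDel hθ (coeffZA δ a) =
      coeffZA δ (δ a) + theta hθ • coeffZA δ (x ^ (p - 1) * σ a) := by
  have := h.twistDelAdd_theta_pow hθ 0 a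
  rw [pow_zero, one_smul, zero_add, pow_one, one_smul] at this
  exact this

theorem mulZA_coeffZA (a b : A) : mulZA δ a (coeffZA δ b) = coeffZA δ (a * b) :=
  (map_mul (coeffZA δ) a b).symm

/-- Multiplication by elements of `A`, as a ring homomorphism. -/
def mulZAHom (δ : SigmaDerivation σ) : A →+* Module.End (ZD δ) (ZA δ) where
  toFun := mulZA δ
  map_one' := LinearMap.ext fun w => by
    change coeffZA δ 1 * w = w
    rw [map_one, one_mul]
  map_zero' := LinearMap.ext fun w => by
    change coeffZA δ 0 * w = 0
    rw [map_zero, zero_mul]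
  map_add' a b := LinearMap.ext fun w => by
    change coeffZA δ (a + b) * w = coeffZA δ a * w + coeffZA δ b * w
    rw [map_add, add_mul]
  map_mul' a b := LinearMap.ext fun w => by
    change coeffZA δ (a * b) * w = coeffZA δ a * (coeffZA δ b * w)
    rw [map_mul, mul_assoc]

theorem mulZAHom_apply (a : A) : mulZAHom δ a = mulZA δ a := rfl

/-- The action of `D_{A,σ}` on `ZA_{A,σ}`. -/
def action (h : IsCoordinate δ p q x) : OreExt δ →+* Module.End (ZD δ) (ZA δ) :=
  liftRingHom (mulZAHom δ) (h.twistDel hθ) fun a => by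
    refine h.linearMap_ext_ZA fun b => ?_
    rw [LinearMap.add_apply, Module.End.mul_apply, Module.End.mul_apply, mulZAHom_apply,
      mulZAHom_apply, mulZAHom_apply, mulZA_coeffZA, mulZA_coeffZA, twistDel_coeffZA,
      twistDel_coeffZA, map_add, map_smul, mulZA_coeffZA, mulZA_coeffZA, δ.leibniz, map_mul σ,
      map_add, mul_left_comm]
    abel

theorem action_monomial (h : IsCoordinate δ p q x) (n : ℕ) (a : A) (w : ZA δ) :
    h.action hθ (monomial δ n a) w = coeffZA δ a * (h.twistDel hθ ^ n) w := by
  rw [action, liftRingHom_monomial]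
  rfl

theorem action_coeff (h : IsCoordinate δ p q x) (a : A) :
    h.action hθ (coeff δ a) = mulZA δ a :=
  LinearMap.ext fun w => h.action_monomial hθ 0 a w

/-- Applying ∂ to the term `θ ^ k x ^ (pk - n)` gives `(pk-n)_q x ^ (pk-n-1) θ ^ k` and `q ^ (pk-n)
x ^ (p-1+pk-n) θ ^ (k+1)`. Collecting powers of θ reproduces the recursion of `divFrob`. -/
theorem twistDel_pow_one (h : IsCoordinate δ p q x) (n : ℕ) :
    (h.twistDel hθ ^ n) 1 = ∑ k ∈ Finset.range (n + 1), theta hθ ^ k •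
      coeffZA δ (algebraMap R A (aeval q (divFrob p n k)) * x ^ (p * k - n)) := by
  have hp := h.prime.ne_zero
  induction n with
  | zero => simp [divFrob_zero_left]
  | succ n ih =>
    have hterm : ∀ k, h.twistDel hθ (theta hθ ^ k •
          coeffZA δ (algebraMap R A (aeval q (divFrob p n k)) * x ^ (p * k - n))) =
        theta hθ ^ k • coeffZA δ (algebraMap R A (aeval q (qInt (p * k - n) * divFrob p n k)) *
          x ^ (p * k - (n + 1))) +
        theta hθ ^ (k + 1) • coeffZA δ (algebraMap R A
          (aeval q (X ^ (p * k - n) * divFrob p n k)) * x ^ (p * (k + 1) - (n + 1))) := by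
      intro k
      rw [map_smul, twistDel_coeffZA, smul_add, smul_smul, ← pow_succ]
      congr 3
      · rw [← Algebra.smul_def, map_smul, h.delta_pow, smul_smul, map_mul, mul_comm,
          Algebra.smul_def, Nat.sub_sub]
      · rw [map_mul, AlgHom.commutes, h.sigma_pow]
        -- The exponents add up only when `pk ≥ n`; otherwise truncated subtraction breaks the
        -- identity, but the coefficient is zero.
        rcases lt_or_ge (p * k) n with hk | hk
        · rw [divFrob_eq_zero_of_mul_lt hp hk]; simp
        · have he : p * (k + 1) - (n + 1) = (p - 1) + (p * k - n) := by
            have := h.prime.pos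
            rw [mul_add, mul_one]; omega
          rw [he, pow_add, map_mul, map_pow, aeval_X, Algebra.smul_def, map_mul]
          ring
    rw [pow_succ', Module.End.mul_apply, ih, map_sum, Finset.sum_congr rfl fun k _ => hterm k,
      Finset.sum_add_distrib, Finset.sum_range_succ' _ (n + 1), divFrob_succ_zero]
    have h0 := Finset.sum_range_succ (fun k => theta hθ ^ k • coeffZA δ (algebraMap R A
      (aeval q (qInt (p * k - n) * divFrob p n k)) * x ^ (p * k - (n + 1)))) (n + 1)
    rw [divFrob_eq_zero (Nat.lt_succ_self n), mul_zero, map_zero, map_zero, zero_mul, map_zero,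
      smul_zero, add_zero] at h0
    rw [← h0, Finset.sum_range_succ', mul_zero, Nat.zero_sub, qInt_zero, zero_mul, map_zero,
      map_zero, zero_mul, map_zero, smul_zero, add_zero, add_zero, ← Finset.sum_add_distrib]
    refine Finset.sum_congr rfl fun k _ => ?_
    rw [← smul_add, ← map_add, ← add_mul, ← map_add, ← map_add, divFrob_succ_succ,
      add_comm (qInt _ * _)]

theorem theta_pow_smul_eq_mul (k : ℕ) (w : ZA δ) :
    theta hθ ^ k • w = w * inclZ δ (theta hθ) ^ k := by
  refine Subtype.ext ?_
  rw [theta_pow_smul_coe, pow_mul]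
  rfl

/-- The divided Frobenius is the orbit map of `1` under the action of `D_{A,σ}`. -/
theorem action_one (h : IsCoordinate δ p q x) (P : OreExt δ) :
    h.action hθ P 1 = Phi hθ q x P := by
  have : (LinearMap.toAddMonoidHom (LinearMap.applyₗ (R := ZD δ) (1 : ZA δ))).comp
      (h.action hθ : OreExt δ →+ Module.End (ZD δ) (ZA δ)) = Phi hθ q x := by
    apply OreExt.addHom_ext
    intro n a
    change h.action hθ (monomial δ n a) 1 = _
    rw [action_monomial, twistDel_pow_one, monomial_eq, Phi_monomial]
    congr 1
    refine Finset.sum_congr rfl fun k _ => ?_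
    rw [polyB_eq_divFrob h.prime.ne_zero]
    exact theta_pow_smul_eq_mul hθ k _
  exact DFunLike.congr_fun this P

theorem action_coeffZA (h : IsCoordinate δ p q x) (P : OreExt δ) (z : A) :
    h.action hθ P (coeffZA δ z) = Phi hθ q x (P * coeff δ z) := by
  rw [← h.action_one hθ, map_mul, Module.End.mul_apply, action_coeff]
  congr 1
  exact (mul_one (coeffZA δ z)).symm

/-! ### Reduction modulo `∂ ^ p` -/

theorem exists_eq_theta_smul (h : IsCoordinate δ p q x) {w : ZA δ}
    (hw : cf δ 0 (w : OreExt δ) = 0) : ∃ y, w = theta hθ • y := by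
  obtain ⟨M, hM⟩ := h.exists_sum_theta hθ w
  refine ⟨∑ k ∈ Finset.range M, theta hθ ^ k • coeffZA δ (cf δ (p * (k + 1)) w), ?_⟩
  have h1 := Finset.sum_range_succ
    (fun k => theta hθ ^ k • coeffZA δ (cf δ (p * k) (w : OreExt δ))) M
  -- The expansion `hM` stops before M, so the coefficient at M vanishes and the index can be
  -- shifted by one.
  have h2 : theta hθ ^ M • coeffZA δ (cf δ (p * M) (w : OreExt δ)) = 0 := by
    by_contra hne
    refine hne (Subtype.ext ?_)
    have h3 := congrArg (fun w : ZA δ => cf δ (p * M) (w : OreExt δ)) hM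
    simp only [AddSubmonoidClass.coe_finsetSum, map_sum, theta_pow_smul_coeffZA_coe,
      cf_monomial] at h3
    rw [Finset.sum_eq_zero fun k hk => by
      rw [if_neg]
      intro h4
      have := Nat.eq_of_mul_eq_mul_left h.prime.pos h4
      exact absurd (Finset.mem_range.1 hk) (by omega)] at h3
    rw [h3, map_zero, smul_zero]
  rw [h2, add_zero, Finset.sum_range_succ', mul_zero, hw, map_zero, smul_zero, add_zero] at h1
  conv_lhs => rw [hM]
  rw [← h1, Finset.smul_sum]
  exact Finset.sum_congr rfl fun k _ => by rw [pow_succ', mul_smul]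

theorem cf_theta_smul (h : IsCoordinate δ p q x) (y : ZA δ) :
    cf δ 0 ((theta hθ • y : ZA δ) : OreExt δ) = 0 := by
  have h1 := theta_pow_smul_coe hθ 1 y
  rw [pow_one, mul_one] at h1
  rw [h1, cf_mul_del_pow, if_neg h.prime.pos.not_ge]

/-- The constant term is reduction modulo θ, under which the summand `x ^ (p - 1) σ(a) θ`
disappears: ∂ acts on A simply by δ. -/
theorem cf_action_monomial (h : IsCoordinate δ p q x) (n : ℕ) (a : A) (w : ZA δ) :
    cf δ 0 (h.action hθ (monomial δ n a) w : OreExt δ) = a * δ^[n] (cf δ 0 (w : OreExt δ)) := by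
  have h1 : ∀ w, cf δ 0 (h.twistDel hθ w : OreExt δ) = δ (cf δ 0 (w : OreExt δ)) := by
    intro w
    have : ((cf δ 0).comp (ZA δ).subtype.toAddMonoidHom).comp (h.twistDel hθ).toAddMonoidHom =
        (δ.toLinearMap : A →+ A).comp ((cf δ 0).comp (ZA δ).subtype.toAddMonoidHom) := by
      refine h.addHom_ext_ZA hθ fun k a => ?_
      change cf δ 0 (h.twistDel hθ (theta hθ ^ k • coeffZA δ a) : OreExt δ) =
        δ (cf δ 0 ((theta hθ ^ k • coeffZA δ a : ZA δ) : OreExt δ))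
      rw [map_smul, twistDel_coeffZA]
      cases k with
      | zero =>
        rw [pow_zero, one_smul, one_smul, Subring.coe_add, map_add, h.cf_theta_smul hθ, add_zero,
          coeffZA_coe, coeffZA_coe, cf_coeff, cf_coeff, if_pos rfl, if_pos rfl]
      | succ k =>
        rw [pow_succ', mul_smul, mul_smul, h.cf_theta_smul hθ, h.cf_theta_smul hθ, map_zero]
    exact DFunLike.congr_fun this w
  have h2 : ∀ w, cf δ 0 ((h.twistDel hθ ^ n) w : OreExt δ) = δ^[n] (cf δ 0 (w : OreExt δ)) := by
    induction n with
    | zero => intro w; rfl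
    | succ n ih =>
      intro w
      rw [pow_succ, Module.End.mul_apply, ih, h1, Function.iterate_succ_apply]
  rw [action_monomial, ← h2, Subring.coe_mul, coeffZA_coe, ← smul_eq_coeff_mul, cf_smul]

theorem iterate_delta_pow_self (h : IsCoordinate δ p q x) (n : ℕ) :
    δ^[n] (x ^ n) = algebraMap R A (aeval q (qFactorial n)) := by
  have := h.iterate_delta_pow_mul n δ.map_one
  rwa [mul_one, ← Algebra.algebraMap_eq_smul_one] at this

theorem iterate_delta_pow_of_lt (h : IsCoordinate δ p q x) {n m : ℕ} (hnm : n < m) :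
    δ^[m] (x ^ n) = 0 := by
  have := h.iterate_delta_of_lt hnm δ.map_one
  rwa [mul_one] at this

theorem exists_action_pow (h : IsCoordinate δ p q x) (t : ℕ → A) :
    ∃ P, ∀ k < p, cf δ 0 (h.action hθ P (coeffZA δ (x ^ k)) : OreExt δ) = t k := by
  have key : ∀ m ≤ p, ∃ P, ∀ k < m,
      cf δ 0 (h.action hθ P (coeffZA δ (x ^ k)) : OreExt δ) = t k := by
    intro m
    induction m with
    | zero => exact fun _ => ⟨0, fun k hk => by omega⟩
    | succ m ih =>
      intro hm
      obtain ⟨P, hP⟩ := ih (by omega)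
      obtain ⟨u, hu⟩ := (isUnit_aeval_qFactorial h.prime h.root
        (show m < p by omega)).map (algebraMap R A)
      -- Triangularity: `δ ^ m` kills `x ^ k` for k < m, so the correction changes only the value at
      -- `x ^ m`, where `δ ^ m(x ^ m) = (m)_q!` is the unit u.
      refine ⟨P + monomial δ m
        ((t m - cf δ 0 (h.action hθ P (coeffZA δ (x ^ m)) : OreExt δ)) * ↑u⁻¹), fun k hk => ?_⟩
      rw [map_add, LinearMap.add_apply, Subring.coe_add, map_add, cf_action_monomial, coeffZA_coe,
        cf_coeff, if_pos rfl]
      rcases Nat.lt_succ_iff_lt_or_eq.1 hk with hk | rfl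
      · rw [h.iterate_delta_pow_of_lt hk, mul_zero, add_zero, hP k hk]
      · rw [h.iterate_delta_pow_self, ← hu, mul_assoc, Units.inv_mul, mul_one]
        abel
  exact key p le_rfl

/-- The same triangular system: once the lower coefficients of P are zero, evaluating at `x ^ k`
leaves only `(k)_q!` times the k-th one. -/
theorem cf_eq_zero_of_action (h : IsCoordinate δ p q x) {P : OreExt δ}
    (hP : ∀ k < p, cf δ 0 (h.action hθ P (coeffZA δ (x ^ k)) : OreExt δ) = 0) :
    ∀ k < p, cf δ k P = 0 := by
  obtain ⟨M, hM⟩ := exists_bound P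
  intro k
  induction k using Nat.strong_induction_on with
  | _ k ih =>
    intro hk
    have h1 := hP k hk
    rw [eq_sum_monomial hM, map_sum, LinearMap.sum_apply, AddSubmonoidClass.coe_finsetSum,
      map_sum] at h1
    simp only [cf_action_monomial, coeffZA_coe, cf_coeff, if_true] at h1
    rw [Finset.sum_eq_single k] at h1
    · rw [h.iterate_delta_pow_self] at h1
      exact (((isUnit_aeval_qFactorial h.prime h.root hk).map
        (algebraMap R A)).mul_left_eq_zero).1 h1
    · intro n _ hn
      rcases lt_or_gt_of_ne hn with hn | hn
      · rw [ih n hn (hn.trans hk), zero_mul]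
      · rw [h.iterate_delta_pow_of_lt hn, mul_zero]
    · intro hkM
      rw [hM k (by simpa using hkM), zero_mul]

theorem del_pow_dvd (h : IsCoordinate δ p q x) {P : OreExt δ} (hP : ∀ k < p, cf δ k P = 0) :
    del δ ^ p ∣ P := by
  obtain ⟨M, hM⟩ := exists_bound P
  refine ⟨∑ n ∈ Finset.range M, monomial δ n (cf δ (n + p) P), ext_cf fun n => ?_⟩
  rw [h.comm, cf_mul_del_pow]
  simp only [map_sum, cf_monomial]
  split_ifs with hn
  · rw [Finset.sum_ite_eq' (Finset.range M) (n - p) fun m => cf δ (m + p) P,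
      Nat.sub_add_cancel hn]
    split_ifs with hm
    · rfl
    · exact hM n (by rw [Finset.mem_range] at hm; omega)
  · exact hP n (by omega)

/-- Right multiplication by an element of `ZA_{A,σ}`. -/
def mulRightZA (s : ZA δ) : Module.End (ZD δ) (ZA δ) where
  toFun w := w * s
  map_add' v w := add_mul v w s
  map_smul' z w := mul_assoc (inclZ δ z) w s

theorem isUnit_constZ (h : IsCoordinate δ p q x) {r : R} (hr : IsUnit r) :
    IsUnit (h.constZ (δ.map_algebraMap r)) := by
  obtain ⟨u, rfl⟩ := hr
  refine IsUnit.of_mul_eq_one (h.constZ (δ.map_algebraMap (↑u⁻¹ : R))) (Subtype.ext ?_)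
  change coeff δ _ * coeff δ _ = 1
  rw [← map_mul, ← map_mul, Units.mul_inv, map_one, map_one]

/-- In `Φ(∂ ^ p)` the term k = 0 vanishes, the term k = 1 is `B_{1,p}(q) θ` with unit coefficient
and exponent `p - p = 0` of `x`, and the others are divisible by `θ ^ 2`. As `∂ ^ p` is central, it
acts on ZA as multiplication by this element. -/
theorem action_del_pow (h : IsCoordinate δ p q x) :
    ∃ (c : ZD δ) (S : Module.End (ZD δ) (ZA δ)), IsUnit c ∧
      h.action hθ (del δ ^ p) = theta hθ • (c • 1 + theta hθ • S) := by
  obtain ⟨m, hm⟩ : ∃ m, p = m + 1 := Nat.exists_eq_succ_of_ne_zero h.prime.ne_zero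
  have hu : IsUnit (aeval q (divFrob p p 1)) := by
    have := isUnit_aeval_divFrob_one h.prime h.root (show m < p by omega)
    rwa [← hm] at this
  have h1 : ∃ s : ZA δ, h.action hθ (del δ ^ p) 1 =
      theta hθ • coeffZA δ (algebraMap R A (aeval q (divFrob p p 1))) +
        theta hθ • theta hθ • s := by
    have h2 : del δ ^ p = monomial δ p 1 := by rw [monomial_eq, map_one, one_mul]
    have h3 : divFrob p p 0 = 0 := by
      conv_lhs => rw [hm]
      exact divFrob_succ_zero _ _
    rw [h2, action_monomial, map_one, one_mul, twistDel_pow_one]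
    conv =>
      enter [1, s, 1, 1, 1]
      rw [hm]
    rw [Finset.sum_range_succ', Finset.sum_range_succ', h3]
    refine ⟨∑ k ∈ Finset.range m, theta hθ ^ k • coeffZA δ
      (algebraMap R A (aeval q (divFrob p p (k + 1 + 1))) * x ^ (p * (k + 1 + 1) - p)), ?_⟩
    rw [Finset.smul_sum, Finset.smul_sum]
    simp only [smul_smul, ← pow_succ', map_zero, zero_mul, smul_zero, add_zero, zero_add, pow_one,
      mul_one, Nat.sub_self, pow_zero]
    rw [add_comm]
  obtain ⟨s, hs⟩ := h1
  refine ⟨_, mulRightZA s, h.isUnit_constZ hu, h.linearMap_ext_ZA fun a => ?_⟩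
  have h4 : h.action hθ (del δ ^ p) (coeffZA δ a) =
      coeffZA δ a * h.action hθ (del δ ^ p) 1 := by
    rw [h.action_coeffZA hθ, h.comm, ← h.action_one hθ, map_mul, Module.End.mul_apply,
      action_coeff]
    rfl
  rw [h4, hs, mul_add, coeffZA_mul_smul, coeffZA_mul_smul, coeffZA_mul_smul, ← map_mul, mul_comm a,
    ← h.constZ_smul_coeffZA (δ.map_algebraMap _), ← smul_add]
  rfl

/-- An operator P can be chosen to agree with T modulo θ on the generators `x ^ i`; then `T - P` has
image in `θ ZA`. Conversely, if P acts as zero modulo θ, its coefficients below p vanish, so `∂ ^ p`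
divides it. -/
theorem isAdicEquiv_action (h : IsCoordinate δ p q x) :
    IsAdicEquiv (h.action hθ) (theta hθ) (del δ ^ p) := by
  have htor : ∀ P : OreExt δ, P * del δ ^ p = 0 → P = 0 := fun P hP => ext_cf fun n => by
    have h1 := congrArg (cf δ (n + p)) hP
    rwa [cf_mul_del_pow, if_pos (by omega), Nat.add_sub_cancel] at h1
  have htors : ∀ z : ZA δ, theta hθ • z = 0 → z = 0 := fun z hz => by
    have h1 := theta_pow_smul_coe hθ 1 z
    rw [pow_one, mul_one, hz] at h1
    exact Subtype.ext (htor _ h1.symm)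
  refine ⟨h.comm, fun P hP => htor P (by rw [← h.comm, hP]), htors, h.action_del_pow hθ,
    fun T => ?_, fun P T' hP => ?_⟩
  · obtain ⟨P, hP⟩ := h.exists_action_pow hθ fun k => cf δ 0 (T (coeffZA δ (x ^ k)) : OreExt δ)
    have h1 : (⊤ : Submodule (ZD δ) (ZA δ)) ≤ Submodule.comap (T - h.action hθ P)
        (LinearMap.range (theta hθ • (1 : Module.End (ZD δ) (ZA δ)))) := by
      refine h.span_pow.trans (Submodule.span_le.2 ?_)
      rintro _ ⟨i, rfl⟩
      obtain ⟨y, hy⟩ := h.exists_eq_theta_smul hθ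
        (w := (T - h.action hθ P) (coeffZA δ (x ^ (i : ℕ)))) (by
          rw [LinearMap.sub_apply, AddSubgroupClass.coe_sub, map_sub, hP i i.2, sub_self])
      exact ⟨y, hy.symm⟩
    obtain ⟨T', hT'⟩ := exists_eq_smul_of_range htors 1 (T - h.action hθ P) fun z => by
      obtain ⟨y, hy⟩ := h1 (Submodule.mem_top (x := z))
      exact ⟨y, by rw [pow_one]; exact hy.symm⟩
    exact ⟨P, T', by rw [pow_one] at hT'; rw [← hT']; abel⟩
  · refine h.del_pow_dvd (h.cf_eq_zero_of_action hθ fun k _ => ?_)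
    rw [hP]
    exact h.cf_theta_smul hθ _

end IsCoordinate

end TwistedDiff
end

/-! ### Existence and uniqueness of the isomorphism -/

theorem mainTheorem3 {R A : Type*} [CommRing R] [CommRing A] [Algebra R A]
    (p : ℕ) [Fact p.Prime] (q : R)
    (hq : aeval q (TwistedDiff.qInt p) = 0) (hdiv : TwistedDiff.IsQDivisible q)
    (f : R[X] →ₐ[R] A) (hf : f.toRingHom.Etale)
    (σ : A →ₐ[R] A) (hσ : σ (f X) = q • f X) (hσp : ∀ a, σ^[p] a = a)
    (δ : TwistedDiff.SigmaDerivation σ) (hδ : δ (f X) = 1) :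
    ∃ hθ : TwistedDiff.OreExt.del δ ^ p ∈ Subring.center (TwistedDiff.OreExt δ),
      ∃! e : TwistedDiff.Completion (TwistedDiff.OreExt δ) (TwistedDiff.OreExt.del δ ^ p) ≃+*
          Module.End (TwistedDiff.OreExt.ZDHat hθ) (TwistedDiff.OreExt.ZAHat hθ),
        (∀ a : A,
          e (TwistedDiff.Completion.of _ (TwistedDiff.OreExt.coeff δ a)) =
            AdicCompletion.map _ (TwistedDiff.OreExt.mulZA δ a)) ∧
        (∀ (P : TwistedDiff.OreExt δ) (z : A),
          e (TwistedDiff.Completion.of _ P)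
              (AdicCompletion.of _ _ (TwistedDiff.OreExt.coeffZA δ z)) =
            AdicCompletion.of _ _
              (TwistedDiff.OreExt.Phi hθ q (f X) (P * TwistedDiff.OreExt.coeff δ z))) := by
  have h := TwistedDiff.isCoordinate_of_etale Fact.out hq f hf hσ hσp δ hδ
  have hθ := h.del_pow_mem_center
  have hE := h.isAdicEquiv_action hθ
  have := h.projective_ZA
  have hof : ∀ (T : Module.End (TwistedDiff.OreExt.ZD δ) (TwistedDiff.OreExt.ZA δ))
      (z : TwistedDiff.OreExt.ZA δ), AdicCompletion.map (Ideal.span {TwistedDiff.OreExt.theta hθ}) T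
      (AdicCompletion.of _ (TwistedDiff.OreExt.ZA δ) z) = AdicCompletion.of _ _ (T z) :=
    fun T z => AdicCompletion.map_of _ T z
  have huniq : ∀ e : TwistedDiff.Completion (TwistedDiff.OreExt δ)
        (TwistedDiff.OreExt.del δ ^ p) ≃+*
          Module.End (TwistedDiff.OreExt.ZDHat hθ) (TwistedDiff.OreExt.ZAHat hθ),
      (∀ (P : TwistedDiff.OreExt δ) (z : A),
          e (TwistedDiff.Completion.of _ P)
              (AdicCompletion.of _ _ (TwistedDiff.OreExt.coeffZA δ z)) =
            AdicCompletion.of _ _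
              (TwistedDiff.OreExt.Phi hθ q (f X) (P * TwistedDiff.OreExt.coeff δ z))) →
      ∀ P, e (TwistedDiff.Completion.of _ P) = AdicCompletion.map _ (h.action hθ P) := by
    intro e he P
    refine TwistedDiff.adicCompletion_end_ext fun z => ?_
    -- A generates ZA over ZD, so the values Φ(Pz) for z in A determine `e(P)` on ZA, and by
    -- continuity on its completion.
    have h1 : ((e (TwistedDiff.Completion.of _ P)).restrictScalars _) ∘ₗ
          AdicCompletion.of (Ideal.span {TwistedDiff.OreExt.theta hθ}) (TwistedDiff.OreExt.ZA δ) =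
        AdicCompletion.of _ _ ∘ₗ h.action hθ P := by
      refine h.linearMap_ext_ZA fun a => ?_
      rw [LinearMap.comp_apply, LinearMap.comp_apply, h.action_coeffZA hθ]
      exact he P a
    rw [hof]
    exact LinearMap.congr_fun h1 z
  refine ⟨hθ, hE.equiv, ⟨fun a => ?_, fun P z => ?_⟩, fun e he => ?_⟩
  · rw [hE.equiv_of, h.action_coeff]
  · rw [hE.equiv_of, hof, h.action_coeffZA]
  · refine RingEquiv.ext fun s => ?_
    have h2 := hE.ringHom_ext (e := (e : _ →+* _)) (e' := (hE.equiv : _ →+* _))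
      (huniq e he.2) hE.equiv_of
    exact RingHom.congr_fun h2 s
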